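/- All monoidal categories and monoidal functors below are strict. An \emph{idempotent object} of a monoidal category $\mathcal{M}$ is a pair $(M,\mu)$ consisting of an object $M$ of $\mathcal{M}$ and an isomorphism $\mu : M\otimes M\to M$. A monoidal category $\mathcal{A}$ is \emph{freely generated by} an idempotent object $(A,\alpha)$ in $\mathcal{A}$ if for every monoidal category $\mathcal{M}$ and every idempotent object $(M,\mu)$ in $\mathcal{M}$ there is a unique monoidal functor $G:\mathcal{A}\to\mathcal{M}$ such that $G(A)=M$ and $G(\alpha)=\mu$. \emph{Thompson's group} $F$ is the group, under composition, of all bijections $f:[0,1]\to[0,1]$ that are (continuous and) piecewise linear with finitely many pieces, such that the slope of each piece is an integer power of $2$ and the coordinates of the endpoints of each piece are dyadic rationals. \textbf{Theorem.} There exists a monoidal category freely generated by an idempotent object. Moreover, if $\mathcal{A}$ is any monoidal category freely generated by an idempotent object $(A,\alpha)$, then the automorphism group $\mathrm{Aut}_{\mathcal{A}}(A)$ is isomorphic to Thompson's group $F$, and $\mathcal{A}$ is equivalent, as a category, to the groupoid $1\amalg F$, the coproduct of the trivial group and the group $F$, each regarded as a one-object groupoid. -/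

import Mathlib

open CategoryTheory MonoidalCategory

universe v u v₁ u₁ v₂ u₂

/-! ### Strict monoidal categories and strict monoidal functors -/

/-- A monoidal category is *strict* if the associativity and unit laws hold on the nose, that is,
the associator and the unitors are identities (transported along equalities of objects). -/
class StrictMonoidal (C : Type u) [Category.{v} C] [MonoidalCategory C] : Prop where
  tensor_assoc : ∀ X Y Z : C, (X ⊗ Y) ⊗ Z = X ⊗ (Y ⊗ Z)
  unit_tensor : ∀ X : C, 𝟙_ C ⊗ X = X
  tensor_unit : ∀ X : C, X ⊗ 𝟙_ C = X
  associator_eq : ∀ X Y Z : C, α_ X Y Z = eqToIso (tensor_assoc X Y Z)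
  leftUnitor_eq : ∀ X : C, λ_ X = eqToIso (unit_tensor X)
  rightUnitor_eq : ∀ X : C, ρ_ X = eqToIso (tensor_unit X)

/-- A functor is *strict monoidal* if it preserves the unit and the tensor product, of objects and
of maps, on the nose. -/
structure IsStrictMonoidalFunctor {C : Type u₁} [Category.{v₁} C] [MonoidalCategory C]
    {D : Type u₂} [Category.{v₂} D] [MonoidalCategory D] (G : C ⥤ D) : Prop where
  obj_unit : G.obj (𝟙_ C) = 𝟙_ D
  obj_tensor : ∀ X Y : C, G.obj (X ⊗ Y) = G.obj X ⊗ G.obj Y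
  map_tensor : ∀ {X X' Y Y' : C} (f : X ⟶ X') (g : Y ⟶ Y'),
    G.map (f ⊗ₘ g) =
      eqToHom (obj_tensor X Y) ≫ (G.map f ⊗ₘ G.map g) ≫ eqToHom (obj_tensor X' Y').symm

/-! ### Idempotent objects -/

/-- An *idempotent object* of a monoidal category: an object `M` together with an isomorphism
`M ⊗ M ≅ M`. -/
structure IdempotentObject (C : Type u) [Category.{v} C] [MonoidalCategory C] where
  obj : C
  iso : obj ⊗ obj ≅ obj

/-- The image `(G A, G α)` of an idempotent object `(A, α)` under a strict monoidal functor `G`.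
The isomorphism is `G α`, regarded as a map `G A ⊗ G A = G (A ⊗ A) ⟶ G A`. -/
def IdempotentObject.map {C : Type u₁} [Category.{v₁} C] [MonoidalCategory C]
    {D : Type u₂} [Category.{v₂} D] [MonoidalCategory D]
    (a : IdempotentObject C) (G : C ⥤ D) (hG : IsStrictMonoidalFunctor G) :
    IdempotentObject D where
  obj := G.obj a.obj
  iso := eqToIso (hG.obj_tensor a.obj a.obj).symm ≪≫ G.mapIso a.iso

/-- The monoidal category `C` is *freely generated by* its idempotent object `a`: for every strict
monoidal category `D` and every idempotent object `b` of `D` there is a unique strict monoidal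
functor `C ⥤ D` that sends `a` to `b`. -/
def IsFreelyGeneratedBy (C : Type u) [Category.{v} C] [MonoidalCategory C]
    (a : IdempotentObject C) : Prop :=
  ∀ (D : Type u) [Category.{v} D] [MonoidalCategory D] [StrictMonoidal D]
    (b : IdempotentObject D),
    ∃! G : C ⥤ D, ∃ hG : IsStrictMonoidalFunctor G, a.map G hG = b

/-! ### Thompson's group `F` -/

/-- Dyadic rationals, as real numbers. -/
def IsDyadic (x : ℝ) : Prop := ∃ (a : ℤ) (n : ℕ), x = a / 2 ^ n

/-- `f : [0, 1] → [0, 1]` is piecewise linear with pieces the closed intervals `[a, b]` between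
consecutive elements of a finite set `S` (containing `0` and `1`), the slope of each piece is an
integer power of `2`, and both coordinates of the endpoints of each piece are dyadic. -/
def IsDyadicPL (f : unitInterval → unitInterval) : Prop :=
  ∃ S : Finset unitInterval, 0 ∈ S ∧ 1 ∈ S ∧
    (∀ s ∈ S, IsDyadic (s : ℝ) ∧ IsDyadic (f s : ℝ)) ∧
    ∀ a ∈ S, ∀ b ∈ S, a < b → (∀ s ∈ S, ¬ (a < s ∧ s < b)) →
      ∃ k : ℤ, ∀ x : unitInterval, a ≤ x → x ≤ b →
        (f x : ℝ) = f a + (2 : ℝ) ^ k * ((x : ℝ) - a)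

theorem exists_consecutive (S : Finset unitInterval) (h0 : 0 ∈ S) (h1 : 1 ∈ S)
    {x y : unitInterval} (hxy : x < y) (h : ∀ s ∈ S, ¬ (x < s ∧ s < y)) :
    ∃ a ∈ S, ∃ b ∈ S, a ≤ x ∧ y ≤ b ∧ a < b ∧ ∀ s ∈ S, ¬ (a < s ∧ s < b) := by
  have hA : (S.filter (· ≤ x)).Nonempty := ⟨0, by simp [h0]⟩
  have hB : (S.filter (y ≤ ·)).Nonempty := ⟨1, by simp [h1, unitInterval.le_one']⟩
  obtain ⟨a, ha, hamax⟩ := Finset.exists_max_image _ id hA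
  obtain ⟨b, hb, hbmin⟩ := Finset.exists_min_image _ id hB
  simp only [Finset.mem_filter, id] at ha hb hamax hbmin
  refine ⟨a, ha.1, b, hb.1, ha.2, hb.2, lt_of_le_of_lt ha.2 (lt_of_lt_of_le hxy hb.2), ?_⟩
  rintro s hs ⟨h2, h3⟩
  rcases le_or_gt s x with h4 | h4
  · exact absurd (hamax s ⟨hs, h4⟩) (not_le.2 h2)
  · rcases le_or_gt y s with h5 | h5
    · exact absurd (hbmin s ⟨hs, h5⟩) (not_le.2 h3)
    · exact h s hs ⟨h4, h5⟩

theorem affine_of_no_break {f : unitInterval → unitInterval} {S : Finset unitInterval}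
    (h0 : 0 ∈ S) (h1 : 1 ∈ S)
    (hS : ∀ a ∈ S, ∀ b ∈ S, a < b → (∀ s ∈ S, ¬ (a < s ∧ s < b)) →
      ∃ k : ℤ, ∀ x : unitInterval, a ≤ x → x ≤ b →
        (f x : ℝ) = f a + (2 : ℝ) ^ k * ((x : ℝ) - a))
    {x y : unitInterval} (hxy : x < y) (h : ∀ s ∈ S, ¬ (x < s ∧ s < y)) :
    ∃ k : ℤ, ∀ z : unitInterval, x ≤ z → z ≤ y →
      (f z : ℝ) = f x + (2 : ℝ) ^ k * ((z : ℝ) - x) := by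
  obtain ⟨a, ha, b, hb, hax, hyb, hab, hc⟩ := exists_consecutive S h0 h1 hxy h
  obtain ⟨k, hk⟩ := hS a ha b hb hab hc
  refine ⟨k, fun z hz1 hz2 => ?_⟩
  rw [hk z (hax.trans hz1) (hz2.trans hyb), hk x hax (hxy.le.trans hyb)]
  ring

theorem IsDyadicPL.strictMono {f : unitInterval → unitInterval} (hf : IsDyadicPL f) :
    StrictMono f := by
  obtain ⟨S, h0, h1, -, hS⟩ := hf
  suffices H : ∀ n : ℕ, ∀ x y : unitInterval, x < y →
      (S.filter (fun s => x < s ∧ s < y)).card ≤ n → f x < f y from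
    fun x y hxy => H _ x y hxy le_rfl
  have base : ∀ x y : unitInterval, x < y → (∀ s ∈ S, ¬ (x < s ∧ s < y)) → f x < f y := by
    intro x y hxy h
    obtain ⟨k, hk⟩ := affine_of_no_break h0 h1 hS hxy h
    have h3 := hk y hxy.le le_rfl
    have h4 : (0 : ℝ) < (2 : ℝ) ^ k * ((y : ℝ) - x) :=
      mul_pos (by positivity) (sub_pos.2 hxy)
    rw [← Subtype.coe_lt_coe]
    linarith
  intro n
  induction n with
  | zero =>
    intro x y hxy hn
    refine base x y hxy fun s hs hsxy => ?_
    have : 0 < (S.filter (fun s => x < s ∧ s < y)).card :=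
      Finset.card_pos.2 ⟨s, Finset.mem_filter.2 ⟨hs, hsxy⟩⟩
    omega
  | succ n ih =>
    intro x y hxy hn
    by_cases h : ∀ s ∈ S, ¬ (x < s ∧ s < y)
    · exact base x y hxy h
    push Not at h
    obtain ⟨s, hs, hxs, hsy⟩ := h
    have hmem : s ∈ S.filter (fun t => x < t ∧ t < y) := Finset.mem_filter.2 ⟨hs, hxs, hsy⟩
    refine (ih x s hxs ?_).trans (ih s y hsy ?_)
    · refine Nat.le_of_lt_succ (lt_of_lt_of_le (Finset.card_lt_card ?_) hn)
      refine (Finset.ssubset_iff_of_subset fun t ht => ?_).2 ⟨s, hmem, by simp⟩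
      simp only [Finset.mem_filter] at ht ⊢
      exact ⟨ht.1, ht.2.1, ht.2.2.trans hsy⟩
    · refine Nat.le_of_lt_succ (lt_of_lt_of_le (Finset.card_lt_card ?_) hn)
      refine (Finset.ssubset_iff_of_subset fun t ht => ?_).2 ⟨s, hmem, by simp⟩
      simp only [Finset.mem_filter] at ht ⊢
      exact ⟨ht.1, hxs.trans ht.2.1, ht.2.2⟩

theorem IsDyadic.add {x y : ℝ} (hx : IsDyadic x) (hy : IsDyadic y) : IsDyadic (x + y) := by
  obtain ⟨a, m, rfl⟩ := hx
  obtain ⟨b, n, rfl⟩ := hy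
  exact ⟨a * 2 ^ n + b * 2 ^ m, m + n, by push_cast; field_simp; ring⟩

theorem IsDyadic.sub {x y : ℝ} (hx : IsDyadic x) (hy : IsDyadic y) : IsDyadic (x - y) := by
  obtain ⟨a, m, rfl⟩ := hx
  obtain ⟨b, n, rfl⟩ := hy
  exact ⟨a * 2 ^ n - b * 2 ^ m, m + n, by push_cast; field_simp; ring⟩

theorem IsDyadic.zpow_mul {x : ℝ} (hx : IsDyadic x) (k : ℤ) : IsDyadic ((2 : ℝ) ^ k * x) := by
  obtain ⟨a, m, rfl⟩ := hx
  obtain ⟨n, rfl | rfl⟩ := k.eq_nat_or_neg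
  · exact ⟨a * 2 ^ n, m, by push_cast; rw [zpow_natCast]; ring⟩
  · exact ⟨a, m + n, by rw [zpow_neg, zpow_natCast]; field_simp; ring⟩

theorem IsDyadicPL.isDyadic_apply_iff {f : unitInterval → unitInterval} (hf : IsDyadicPL f)
    (x : unitInterval) : IsDyadic (f x : ℝ) ↔ IsDyadic (x : ℝ) := by
  obtain ⟨S, h0, h1, hd, hS⟩ := hf
  rcases eq_or_lt_of_le (unitInterval.le_one' (t := x)) with rfl | hx
  · exact iff_of_true (hd 1 h1).2 (hd 1 h1).1
  by_cases hxS : x ∈ S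
  · exact iff_of_true (hd x hxS).2 (hd x hxS).1
  have hne : (S.filter (x < ·)).Nonempty := ⟨1, by simp [h1, hx]⟩
  obtain ⟨y, hy, hymin⟩ := Finset.exists_min_image _ id hne
  simp only [Finset.mem_filter, id] at hy hymin
  obtain ⟨a, ha, b, hb, hax, hyb, hab, hc⟩ := exists_consecutive S h0 h1 hy.2
    (fun s hs h => absurd (hymin s ⟨hs, h.1⟩) (not_le.2 h.2))
  obtain ⟨k, hk⟩ := hS a ha b hb hab hc
  have e := hk x hax (hy.2.le.trans hyb)
  constructor
  · intro h
    have e2 : (x : ℝ) = (2 : ℝ) ^ (-k) * ((f x : ℝ) - f a) + a := by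
      rw [e, zpow_neg]; field_simp; ring
    rw [e2]
    exact ((h.sub (hd a ha).2).zpow_mul _).add (hd a ha).1
  · intro h
    rw [e]
    exact (hd a ha).2.add ((h.sub (hd a ha).1).zpow_mul k)

theorem IsDyadicPL.one : IsDyadicPL (1 : Equiv.Perm unitInterval) := by
  refine ⟨{0, 1}, by simp, by simp, ?_, fun a _ b _ _ _ => ⟨0, fun x _ _ => by simp⟩⟩
  intro s hs
  simp only [Finset.mem_insert, Finset.mem_singleton] at hs
  rcases hs with rfl | rfl
  · exact ⟨⟨0, 0, by simp⟩, ⟨0, 0, by simp⟩⟩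
  · exact ⟨⟨1, 0, by simp⟩, ⟨1, 0, by simp⟩⟩

theorem IsDyadicPL.mul {f g : Equiv.Perm unitInterval} (hf : IsDyadicPL f) (hg : IsDyadicPL g) :
    IsDyadicPL (f * g : Equiv.Perm unitInterval) := by
  classical
  have mg := hg.strictMono
  have df := hf.isDyadic_apply_iff
  have dg := hg.isDyadic_apply_iff
  obtain ⟨S, h0, h1, hd, hS⟩ := hf
  obtain ⟨T, k0, k1, hdT, hT⟩ := hg
  have key : ∀ s, s ∈ S → g.symm s ∈ T ∪ S.image g.symm := fun s hs =>
    Finset.mem_union_right _ (Finset.mem_image_of_mem _ hs)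
  refine ⟨T ∪ S.image g.symm, Finset.mem_union_left _ k0, Finset.mem_union_left _ k1, ?_, ?_⟩
  · intro s hs
    have hsd : IsDyadic (s : ℝ) := by
      rcases Finset.mem_union.1 hs with hs | hs
      · exact (hdT s hs).1
      · obtain ⟨t, ht, rfl⟩ := Finset.mem_image.1 hs
        rw [← dg, Equiv.apply_symm_apply]
        exact (hd t ht).1
    refine ⟨hsd, ?_⟩
    rw [Equiv.Perm.mul_apply, df, dg]
    exact hsd
  · intro a _ b _ hab hc
    obtain ⟨k, hk⟩ := affine_of_no_break k0 k1 hT hab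
      (fun s hs => hc s (Finset.mem_union_left _ hs))
    obtain ⟨l, hl⟩ := affine_of_no_break h0 h1 hS (mg hab) (by
      rintro s hs ⟨h2, h3⟩
      refine hc _ (key s hs) ⟨?_, ?_⟩
      · rw [← mg.lt_iff_lt, Equiv.apply_symm_apply]; exact h2
      · rw [← mg.lt_iff_lt, Equiv.apply_symm_apply]; exact h3)
    refine ⟨l + k, fun x hax hxb => ?_⟩
    rw [Equiv.Perm.mul_apply, Equiv.Perm.mul_apply,
      hl (g x) (mg.monotone hax) (mg.monotone hxb), hk x hax hxb,
      zpow_add₀ (by norm_num : (2 : ℝ) ≠ 0)]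
    ring

theorem IsDyadicPL.inv {f : Equiv.Perm unitInterval} (hf : IsDyadicPL f) :
    IsDyadicPL (f⁻¹ : Equiv.Perm unitInterval) := by
  classical
  have mf := hf.strictMono
  have df := hf.isDyadic_apply_iff
  obtain ⟨S, h0, h1, hd, hS⟩ := hf
  have e : ∀ x, f (f⁻¹ x) = x := fun x => f.apply_symm_apply x
  have e' : ∀ x, f⁻¹ (f x) = x := fun x => f.symm_apply_apply x
  have f0 : f 0 = 0 := le_antisymm
    (by have := mf.monotone (unitInterval.nonneg' (t := f⁻¹ 0)); rwa [e] at this)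
    unitInterval.nonneg'
  have f1 : f 1 = 1 := le_antisymm unitInterval.le_one'
    (by have := mf.monotone (unitInterval.le_one' (t := f⁻¹ 1)); rwa [e] at this)
  refine ⟨S.image f, Finset.mem_image.2 ⟨0, h0, f0⟩, Finset.mem_image.2 ⟨1, h1, f1⟩, ?_, ?_⟩
  · intro s hs
    obtain ⟨t, ht, rfl⟩ := Finset.mem_image.1 hs
    rw [e']
    exact (hd t ht).symm
  · intro a ha b hb hab hc
    obtain ⟨a, ha', rfl⟩ := Finset.mem_image.1 ha
    obtain ⟨b, hb', rfl⟩ := Finset.mem_image.1 hb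
    obtain ⟨k, hk⟩ := hS a ha' b hb' (mf.lt_iff_lt.1 hab) (fun s hs h =>
      hc (f s) (Finset.mem_image_of_mem _ hs) ⟨mf h.1, mf h.2⟩)
    refine ⟨-k, fun x hax hxb => ?_⟩
    have h3 := hk (f⁻¹ x) (by rw [← mf.le_iff_le, e]; exact hax)
      (by rw [← mf.le_iff_le, e]; exact hxb)
    rw [e] at h3
    rw [e', h3, zpow_neg]
    field_simp
    ring

/-- *Thompson's group `F`*: all bijections `[0, 1] → [0, 1]` that are piecewise linear with
finitely many pieces, all slopes integer powers of `2`, and dyadic endpoints of the pieces; the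
product is composition. -/
def ThompsonF : Subgroup (Equiv.Perm unitInterval) where
  carrier := {f | IsDyadicPL f}
  one_mem' := IsDyadicPL.one
  mul_mem' := IsDyadicPL.mul
  inv_mem' := IsDyadicPL.inv

/-!
The free strict monoidal category on an idempotent object is realised concretely. Its objects are
the intervals `[0, n]`, its morphisms are the maps `[0, m] → [0, n]` generated under composition
and juxtaposition by the halving map `[0, 2] → [0, 1]` and its inverse (`DyadicMap`), and its
generator is `[0, 1]` with the halving map.

In any strict monoidal category with an idempotent object `(A, α)`, a binary forest prescribes an
invertible arrow `A ⊗ ⋯ ⊗ A ⟶ A ⊗ ⋯ ⊗ A`, from one factor for each leaf to one factor for each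
root, in which every node stands for `α`. Since any two forests with equally many roots have a
common refinement (`BinTree.exists_common_forestGraft`), the fractions `φ⁻¹ ≫ ψ` of forests are
closed under composition, so they exhaust the arrows generated by `α` and `α⁻¹`. In the concrete
category a forest prescribes the piecewise linear map that subdivides the intervals `[0, 1]`, `[1,
2]`, … in the way that the trees indicate. The lengths of the pieces reveal the depths of the
leaves, and these reveal the forest (`DyadicInterval.evalForest_injective`). Therefore two
fractions that agree in the concrete category have a common expansion and agree in every strict
monoidal category (`DyadicInterval.Corresponds.unique`), which makes the functor `φ⁻¹ ≫ ψ ↦ φ⁻¹ ≫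
ψ` well defined. This is the universal property, `DyadicInterval.isFreelyGeneratedBy_generator`.

The endomorphisms of `[0, 1]` in this category are the fractions of two trees, which are visibly
dyadic piecewise linear maps (`DyadicMap.isDyadicPL`). Conversely, an element of Thompson's group
sends the intervals of a sufficiently fine uniform subdivision of `[0, 1]` onto standard dyadic
intervals, and any subdivision of `[0, 1]` into standard dyadic intervals comes from a tree
(`exists_tree_of_isAligned`), so every element of the group occurs
(`IsDyadicPL.dyadicMap_extendPerm`). Finally, all morphisms are invertible, all intervals of
positive length are isomorphic, and `[0, 0]` is isolated with trivial automorphism group; hence the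
category is equivalent to `1 ⨿ F`. The assertions about an arbitrary free category follow from its
uniqueness up to isomorphism.

Dyadic maps are encoded as functions `ℝ → ℝ` that extend the map of intervals by the identity on
the left and by a translation on the right, so that transport along equalities of objects does not
change the function. In a general strict monoidal category the corresponding device is the monoid
`Arr` of all arrows under the tensor product.
-/

/-! ### The monoid of arrows of a strict monoidal category -/

/-- An arrow of `C` together with its source and target. Equalities between arrows whose sources
(or targets) are only propositionally equal are stated in this type, which keeps `eqToHom` out of
the calculations. -/
structure Arr (C : Type u) [Category.{v} C] where
  {src tgt : C}
  hom : src ⟶ tgt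

namespace Arr

section Category

variable {C : Type u} [Category.{v} C]

theorem mk_injective {X Y : C} {f g : X ⟶ Y} (h : Arr.mk f = Arr.mk g) : f = g := by
  cases h
  rfl

@[simp]
theorem mk_comp_eqToHom {X Y Z : C} (f : X ⟶ Y) (h : Y = Z) :
    Arr.mk (f ≫ eqToHom h) = Arr.mk f := by
  subst h
  simp

@[simp]
theorem mk_eqToHom_comp {X Y Z : C} (f : Y ⟶ Z) (h : X = Y) :
    Arr.mk (eqToHom h ≫ f) = Arr.mk f := by
  subst h
  simp

theorem eq_of_mk_eq {X Y X' Y' : C} {f : X ⟶ Y} {g : X' ⟶ Y'} (h : Arr.mk f = Arr.mk g)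
    (hX : X = X') (hY : Y = Y') : f = eqToHom hX ≫ g ≫ eqToHom hY.symm := by
  subst hX hY
  simpa using mk_injective h

open Classical in
/-- The composite of two arrows, in diagrammatic order. It is meaningful only if the target of the
first arrow is the source of the second one; otherwise its value is the first arrow. -/
noncomputable def comp (a b : Arr C) : Arr C :=
  if h : a.tgt = b.src then ⟨a.hom ≫ eqToHom h ≫ b.hom⟩ else a

@[simp]
theorem mk_comp_mk {X Y Z : C} (f : X ⟶ Y) (g : Y ⟶ Z) :
    (Arr.mk f).comp (Arr.mk g) = Arr.mk (f ≫ g) := by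
  simp [comp]

theorem comp_src {a b : Arr C} (h : a.tgt = b.src) : (a.comp b).src = a.src := by
  simp [comp, h]

theorem comp_tgt {a b : Arr C} (h : a.tgt = b.src) : (a.comp b).tgt = b.tgt := by
  simp [comp, h]

theorem comp_assoc {a b c : Arr C} (h : a.tgt = b.src) (h' : b.tgt = c.src) :
    (a.comp b).comp c = a.comp (b.comp c) := by
  obtain ⟨f⟩ := a
  obtain ⟨g⟩ := b
  obtain ⟨k⟩ := c
  dsimp only at h h'
  subst h h'
  simp

theorem comp_id {a : Arr C} {X : C} (h : a.tgt = X) : a.comp ⟨𝟙 X⟩ = a := by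
  subst h
  obtain ⟨f⟩ := a
  simp

theorem id_comp {a : Arr C} {X : C} (h : a.src = X) : (Arr.mk (𝟙 X)).comp a = a := by
  subst h
  obtain ⟨f⟩ := a
  simp

theorem isIso_comp {a b : Arr C} (h : a.tgt = b.src) (ha : IsIso a.hom) (hb : IsIso b.hom) :
    IsIso (a.comp b).hom := by
  obtain ⟨f⟩ := a
  obtain ⟨g⟩ := b
  dsimp only at h ha hb
  subst h
  rw [mk_comp_mk]
  exact IsIso.comp_isIso

theorem comp_left_cancel {a b c : Arr C} (ha : IsIso a.hom) (hb : a.tgt = b.src)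
    (hc : a.tgt = c.src) (h : a.comp b = a.comp c) : b = c := by
  obtain ⟨f⟩ := a
  obtain ⟨g⟩ := b
  obtain ⟨k⟩ := c
  dsimp only at ha hb hc
  subst hb
  subst hc
  rw [mk_comp_mk, mk_comp_mk] at h
  rename_i X Y Z W
  have hW : Z = W := congrArg Arr.tgt h
  subst hW
  rw [(cancel_epi f).1 (mk_injective h)]

end Category

section StrictMonoidal

variable {C : Type u} [Category.{v} C] [MonoidalCategory C]

instance : Mul (Arr C) := ⟨fun a b => ⟨a.hom ⊗ₘ b.hom⟩⟩

instance : One (Arr C) := ⟨⟨𝟙 (𝟙_ C)⟩⟩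

theorem mk_mul_mk {X Y X' Y' : C} (f : X ⟶ Y) (g : X' ⟶ Y') :
    Arr.mk f * Arr.mk g = Arr.mk (f ⊗ₘ g) := rfl

theorem one_def : (1 : Arr C) = ⟨𝟙 (𝟙_ C)⟩ := rfl

theorem mul_src (a b : Arr C) : (a * b).src = a.src ⊗ b.src := rfl

theorem mul_tgt (a b : Arr C) : (a * b).tgt = a.tgt ⊗ b.tgt := rfl

theorem isIso_mul {a b : Arr C} (ha : IsIso a.hom) (hb : IsIso b.hom) : IsIso (a * b).hom :=
  inferInstanceAs (IsIso (a.hom ⊗ₘ b.hom))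

theorem comp_mul_comp {a b a' b' : Arr C} (h : a.tgt = b.src) (h' : a'.tgt = b'.src) :
    a.comp b * a'.comp b' = (a * a').comp (b * b') := by
  obtain ⟨f⟩ := a
  obtain ⟨g⟩ := b
  obtain ⟨f'⟩ := a'
  obtain ⟨g'⟩ := b'
  dsimp only at h h'
  subst h h'
  simp [mk_mul_mk]

/-- In a strict monoidal category the tensor product of arrows is associative and unital. -/
instance [StrictMonoidal C] : Monoid (Arr C) where
  mul_assoc := by
    rintro ⟨f⟩ ⟨g⟩ ⟨h⟩
    have := associator_naturality f g h
    rw [StrictMonoidal.associator_eq, StrictMonoidal.associator_eq] at this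
    have := congrArg Arr.mk this
    rwa [eqToIso.hom, eqToIso.hom, mk_comp_eqToHom, mk_eqToHom_comp] at this
  one_mul := by
    rintro ⟨f⟩
    have := leftUnitor_naturality f
    rw [StrictMonoidal.leftUnitor_eq, StrictMonoidal.leftUnitor_eq] at this
    have := congrArg Arr.mk this
    rwa [eqToIso.hom, eqToIso.hom, mk_comp_eqToHom, mk_eqToHom_comp,
      ← MonoidalCategory.id_tensorHom] at this
  mul_one := by
    rintro ⟨f⟩
    have := rightUnitor_naturality f
    rw [StrictMonoidal.rightUnitor_eq, StrictMonoidal.rightUnitor_eq] at this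
    have := congrArg Arr.mk this
    rwa [eqToIso.hom, eqToIso.hom, mk_comp_eqToHom, mk_eqToHom_comp,
      ← MonoidalCategory.tensorHom_id] at this

end StrictMonoidal

section Functor

variable {C : Type u₁} [Category.{v₁} C] {D : Type u₂} [Category.{v₂} D]

/-- The action of a functor on arrows. -/
def map (G : C ⥤ D) (a : Arr C) : Arr D := ⟨G.map a.hom⟩

theorem map_comp (G : C ⥤ D) {a b : Arr C} (h : a.tgt = b.src) :
    (a.comp b).map G = (a.map G).comp (b.map G) := by
  obtain ⟨f⟩ := a
  obtain ⟨g⟩ := b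
  dsimp only at h
  subst h
  rw [mk_comp_mk]
  simp only [map, G.map_comp, mk_comp_mk]

variable [MonoidalCategory C] [MonoidalCategory D]

theorem map_mul {G : C ⥤ D} (hG : IsStrictMonoidalFunctor G) (a b : Arr C) :
    (a * b).map G = a.map G * b.map G := by
  obtain ⟨f⟩ := a
  obtain ⟨g⟩ := b
  simp [map, mk_mul_mk, hG.map_tensor f g]

theorem map_one {G : C ⥤ D} (hG : IsStrictMonoidalFunctor G) : (1 : Arr C).map G = 1 := by
  rw [one_def, one_def, map, G.map_id, hG.obj_unit]

end Functor

end Arr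

/-! ### Tensor powers -/

section Pow

variable {C : Type u} [Category.{v} C] [MonoidalCategory C]

/-- The `n`-th tensor power `A ⊗ (A ⊗ (⋯ ⊗ 𝟙_ C))`. -/
def tensorPow (A : C) : ℕ → C
  | 0 => 𝟙_ C
  | n + 1 => A ⊗ tensorPow A n

theorem tensorPow_add [StrictMonoidal C] (A : C) (m n : ℕ) :
    tensorPow A (m + n) = tensorPow A m ⊗ tensorPow A n := by
  induction m with
  | zero => rw [Nat.zero_add, tensorPow, StrictMonoidal.unit_tensor]
  | succ m ih => rw [Nat.succ_add, tensorPow, ih, tensorPow, StrictMonoidal.tensor_assoc]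

theorem tensorPow_one [StrictMonoidal C] (A : C) : tensorPow A 1 = A :=
  StrictMonoidal.tensor_unit A

theorem tensorPow_two [StrictMonoidal C] (A : C) : tensorPow A 2 = A ⊗ A :=
  congrArg (A ⊗ ·) (tensorPow_one A)

end Pow

/-! ### Binary forests and their refinements -/

/-- Finite rooted binary trees. A forest is a list of trees. -/
inductive BinTree
  | leaf
  | node (s t : BinTree)

namespace BinTree

/-- The number of leaves of a tree. -/
def leaves : BinTree → ℕ
  | leaf => 1
  | node s t => s.leaves + t.leaves

/-- The number of leaves of a forest. -/
def forestLeaves (φ : List BinTree) : ℕ := (φ.map leaves).sum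

@[simp]
theorem forestLeaves_append (φ ψ : List BinTree) :
    forestLeaves (φ ++ ψ) = forestLeaves φ + forestLeaves ψ := by
  simp [forestLeaves]

/-- `t.Graft χ t'` says that `t'` arises from `t` by grafting the trees of the forest `χ`, in
order, onto the leaves of `t`. -/
inductive Graft : BinTree → List BinTree → BinTree → Prop
  | leaf (c : BinTree) : Graft leaf [c] c
  | node {s t s' t' : BinTree} {χ χ' : List BinTree} :
      Graft s χ s' → Graft t χ' t' → Graft (node s t) (χ ++ χ') (node s' t')

/-- The analogue of `BinTree.Graft` for forests. -/
inductive ForestGraft : List BinTree → List BinTree → List BinTree → Prop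
  | nil : ForestGraft [] [] []
  | cons {t t' : BinTree} {φ φ' χ χ' : List BinTree} :
      Graft t χ t' → ForestGraft φ χ' φ' → ForestGraft (t :: φ) (χ ++ χ') (t' :: φ')

theorem Graft.length_eq {t t' : BinTree} {χ : List BinTree} (h : Graft t χ t') :
    χ.length = t.leaves := by
  induction h with
  | leaf c => rfl
  | node _ _ ih ih' => simp [leaves, ih, ih']

theorem Graft.leaves_eq {t t' : BinTree} {χ : List BinTree} (h : Graft t χ t') :
    t'.leaves = forestLeaves χ := by
  induction h with
  | leaf c => simp [forestLeaves]
  | node _ _ ih ih' => simp [leaves, ih, ih']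

theorem ForestGraft.length_eq {φ φ' χ : List BinTree} (h : ForestGraft φ χ φ') :
    χ.length = forestLeaves φ := by
  induction h with
  | nil => rfl
  | cons h _ ih => simp [forestLeaves, h.length_eq, ih]

theorem ForestGraft.length_eq' {φ φ' χ : List BinTree} (h : ForestGraft φ χ φ') :
    φ'.length = φ.length := by
  induction h with
  | nil => rfl
  | cons h _ ih => simp [ih]

theorem ForestGraft.leaves_eq {φ φ' χ : List BinTree} (h : ForestGraft φ χ φ') :
    forestLeaves φ' = forestLeaves χ := by
  induction h with
  | nil => rfl
  | cons h _ ih =>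
    rw [forestLeaves_append, ← h.leaves_eq, ← ih]
    simp [forestLeaves]

theorem exists_graft (t : BinTree) :
    ∀ {χ : List BinTree}, χ.length = t.leaves → ∃ t', Graft t χ t' := by
  induction t with
  | leaf =>
    intro χ h
    obtain ⟨c, rfl⟩ := List.length_eq_one_iff.1 h
    exact ⟨c, .leaf c⟩
  | node s t ihs iht =>
    intro χ h
    rw [leaves] at h
    obtain ⟨s', hs⟩ := ihs (χ := χ.take s.leaves) (by simp; omega)
    obtain ⟨t', ht⟩ := iht (χ := χ.drop s.leaves) (by simp; omega)
    have := Graft.node hs ht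
    rw [List.take_append_drop] at this
    exact ⟨_, this⟩

theorem exists_forestGraft (φ : List BinTree) :
    ∀ {χ : List BinTree}, χ.length = forestLeaves φ → ∃ φ', ForestGraft φ χ φ' := by
  induction φ with
  | nil =>
    intro χ h
    obtain rfl := List.length_eq_zero_iff.1 h
    exact ⟨[], .nil⟩
  | cons t φ ih =>
    intro χ h
    simp only [forestLeaves, List.map_cons, List.sum_cons] at h
    obtain ⟨t', ht⟩ := exists_graft t (χ := χ.take t.leaves) (by simp; omega)
    obtain ⟨φ', hφ⟩ := ih (χ := χ.drop t.leaves) (by simp [forestLeaves]; omega)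
    have := ForestGraft.cons ht hφ
    rw [List.take_append_drop] at this
    exact ⟨_, this⟩

theorem graft_leaves (t : BinTree) : Graft t (List.replicate t.leaves leaf) t := by
  induction t with
  | leaf => exact .leaf leaf
  | node s t ihs iht =>
    rw [leaves, List.replicate_add]
    exact .node ihs iht

/-- Any two trees have a common refinement. -/
theorem exists_common_graft (s : BinTree) :
    ∀ t : BinTree, ∃ χ χ' r, Graft s χ r ∧ Graft t χ' r := by
  induction s with
  | leaf => exact fun t => ⟨_, _, t, .leaf t, graft_leaves t⟩
  | node s₁ s₂ ih₁ ih₂ =>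
    rintro (_ | ⟨t₁, t₂⟩)
    · exact ⟨_, _, _, graft_leaves _, .leaf _⟩
    · obtain ⟨_, _, _, h₁, h₁'⟩ := ih₁ t₁
      obtain ⟨_, _, _, h₂, h₂'⟩ := ih₂ t₂
      exact ⟨_, _, _, .node h₁ h₂, .node h₁' h₂'⟩

/-- Any two forests with the same number of roots have a common refinement. -/
theorem exists_common_forestGraft (φ : List BinTree) :
    ∀ {ψ : List BinTree}, φ.length = ψ.length →
      ∃ χ χ' ω, ForestGraft φ χ ω ∧ ForestGraft ψ χ' ω := by
  induction φ with
  | nil =>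
    intro ψ h
    obtain rfl := List.length_eq_zero_iff.1 h.symm
    exact ⟨_, _, _, .nil, .nil⟩
  | cons s φ ih =>
    rintro (_ | ⟨t, ψ⟩) h
    · simp at h
    · obtain ⟨_, _, _, h₁, h₁'⟩ := exists_common_graft s t
      obtain ⟨_, _, _, h₂, h₂'⟩ := ih (ψ := ψ) (by simpa using h)
      exact ⟨_, _, _, .cons h₁ h₂, .cons h₁' h₂'⟩

end BinTree

open BinTree

/-! ### Evaluation of forests at an idempotent object -/

namespace IdempotentObject

section Eval

variable {C : Type u} [Category.{v} C] [MonoidalCategory C]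

/-- The arrow `A ⊗ ⋯ ⊗ A ⟶ A` that a tree prescribes, where each node stands for the
multiplication `α : A ⊗ A ⟶ A`. -/
noncomputable def evalTree (e : IdempotentObject C) : BinTree → Arr C
  | leaf => ⟨𝟙 e.obj⟩
  | node s t => (e.evalTree s * e.evalTree t).comp ⟨e.iso.hom⟩

theorem evalTree_tgt (e : IdempotentObject C) (t : BinTree) : (e.evalTree t).tgt = e.obj := by
  induction t with
  | leaf => rfl
  | node s t ihs iht =>
    rw [evalTree, Arr.comp_tgt]
    rw [Arr.mul_tgt, ihs, iht]

theorem evalTree_mul_tgt (e : IdempotentObject C) (s t : BinTree) :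
    (e.evalTree s * e.evalTree t).tgt = e.obj ⊗ e.obj := by
  rw [Arr.mul_tgt, evalTree_tgt, evalTree_tgt]

theorem isIso_evalTree (e : IdempotentObject C) (t : BinTree) : IsIso (e.evalTree t).hom := by
  induction t with
  | leaf => exact IsIso.id e.obj
  | node s t ihs iht =>
    exact Arr.isIso_comp (e.evalTree_mul_tgt s t) (Arr.isIso_mul ihs iht) e.iso.isIso_hom

/-- The arrow that a forest prescribes: the tensor product of the arrows of its trees. -/
noncomputable def evalForest (e : IdempotentObject C) (φ : List BinTree) : Arr C :=
  (φ.map e.evalTree).prod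

theorem evalForest_nil (e : IdempotentObject C) : e.evalForest [] = 1 := rfl

theorem evalForest_cons (e : IdempotentObject C) (t : BinTree) (φ : List BinTree) :
    e.evalForest (t :: φ) = e.evalTree t * e.evalForest φ := by
  simp [evalForest]

theorem evalForest_tgt (e : IdempotentObject C) (φ : List BinTree) :
    (e.evalForest φ).tgt = tensorPow e.obj φ.length := by
  induction φ with
  | nil => rfl
  | cons t φ ih => rw [evalForest_cons, Arr.mul_tgt, evalTree_tgt, ih]; rfl

theorem isIso_evalForest (e : IdempotentObject C) (φ : List BinTree) :
    IsIso (e.evalForest φ).hom := by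
  induction φ with
  | nil => exact IsIso.id (𝟙_ C)
  | cons t φ ih =>
    rw [evalForest_cons]
    exact Arr.isIso_mul (e.isIso_evalTree t) ih

variable [StrictMonoidal C]

theorem evalTree_src (e : IdempotentObject C) (t : BinTree) :
    (e.evalTree t).src = tensorPow e.obj t.leaves := by
  induction t with
  | leaf => exact (tensorPow_one _).symm
  | node s t ihs iht =>
    rw [evalTree, Arr.comp_src (e.evalTree_mul_tgt s t), Arr.mul_src, ihs, iht, leaves,
      tensorPow_add]

theorem evalForest_singleton (e : IdempotentObject C) (t : BinTree) :
    e.evalForest [t] = e.evalTree t := by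
  simp [evalForest]

theorem evalForest_append (e : IdempotentObject C) (φ ψ : List BinTree) :
    e.evalForest (φ ++ ψ) = e.evalForest φ * e.evalForest ψ := by
  simp [evalForest]

theorem evalForest_src (e : IdempotentObject C) (φ : List BinTree) :
    (e.evalForest φ).src = tensorPow e.obj (forestLeaves φ) := by
  induction φ with
  | nil => rfl
  | cons t φ ih =>
    rw [evalForest_cons, Arr.mul_src, evalTree_src, ih, ← tensorPow_add]
    simp [forestLeaves]

theorem evalTree_of_graft (e : IdempotentObject C) {t t' : BinTree} {χ : List BinTree}
    (h : Graft t χ t') : e.evalTree t' = (e.evalForest χ).comp (e.evalTree t) := by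
  induction h with
  | leaf c => rw [evalForest_singleton, evalTree, Arr.comp_id (e.evalTree_tgt c)]
  | @node s t s' t' χ χ' h h' ih ih' =>
    have h₁ : (e.evalForest χ).tgt = (e.evalTree s).src := by
      rw [evalForest_tgt, evalTree_src, h.length_eq]
    have h₂ : (e.evalForest χ').tgt = (e.evalTree t).src := by
      rw [evalForest_tgt, evalTree_src, h'.length_eq]
    rw [evalTree, ih, ih', Arr.comp_mul_comp h₁ h₂, evalForest_append, evalTree,
      Arr.comp_assoc _ (e.evalTree_mul_tgt s t)]
    rw [Arr.mul_tgt, Arr.mul_src, h₁, h₂]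

theorem evalForest_of_graft (e : IdempotentObject C) {φ φ' χ : List BinTree}
    (h : ForestGraft φ χ φ') : e.evalForest φ' = (e.evalForest χ).comp (e.evalForest φ) := by
  induction h with
  | nil => rw [evalForest_nil, Arr.one_def, Arr.mk_comp_mk, Category.comp_id]
  | @cons t t' φ φ' χ χ' h h' ih =>
    rw [evalForest_cons, ih, e.evalTree_of_graft h, Arr.comp_mul_comp, evalForest_append,
      evalForest_cons]
    · rw [evalForest_tgt, evalTree_src, h.length_eq]
    · rw [evalForest_tgt, evalForest_src, h'.length_eq]

end Eval

/-! ### Arrows as fractions of forests -/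

section Represents

variable {C : Type u} [Category.{v} C] [MonoidalCategory C]

/-- The arrow `a` between tensor powers of the idempotent object is the fraction `φ⁻¹ ≫ ψ` of two
forests with equally many leaves. -/
structure Represents (e : IdempotentObject C) (φ ψ : List BinTree) (a : Arr C) : Prop where
  leaves_eq : forestLeaves φ = forestLeaves ψ
  src_eq : a.src = tensorPow e.obj φ.length
  tgt_eq : a.tgt = tensorPow e.obj ψ.length
  comp_eq : (e.evalForest φ).comp a = e.evalForest ψ

variable {e : IdempotentObject C} {φ ψ φ' ψ' : List BinTree} {a b : Arr C}

theorem Represents.tgt_eq_src (h : e.Represents φ ψ a) : (e.evalForest φ).tgt = a.src := by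
  rw [evalForest_tgt, h.src_eq]

theorem Represents.id (e : IdempotentObject C) (φ : List BinTree) :
    e.Represents φ φ ⟨𝟙 (tensorPow e.obj φ.length)⟩ :=
  ⟨rfl, rfl, rfl, Arr.comp_id (e.evalForest_tgt φ)⟩

theorem Represents.inv {X Y : C} {f : X ≅ Y} (h : e.Represents φ ψ ⟨f.hom⟩) :
    e.Represents ψ φ ⟨f.inv⟩ where
  leaves_eq := h.leaves_eq.symm
  src_eq := h.tgt_eq
  tgt_eq := h.src_eq
  comp_eq := by
    rw [← h.comp_eq, Arr.comp_assoc h.tgt_eq_src rfl, Arr.mk_comp_mk, f.hom_inv_id,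
      Arr.comp_id h.tgt_eq_src]

theorem Represents.comp (h : e.Represents φ ψ a) (h' : e.Represents ψ ψ' b) :
    e.Represents φ ψ' (a.comp b) := by
  have hab : a.tgt = b.src := by rw [h.tgt_eq, h'.src_eq]
  exact
    { leaves_eq := h.leaves_eq.trans h'.leaves_eq
      src_eq := by rw [Arr.comp_src hab, h.src_eq]
      tgt_eq := by rw [Arr.comp_tgt hab, h'.tgt_eq]
      comp_eq := by rw [← Arr.comp_assoc h.tgt_eq_src hab, h.comp_eq, h'.comp_eq] }

/-- An arrow is determined by a fraction that represents it. -/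
theorem Represents.unique (h : e.Represents φ ψ a) (h' : e.Represents φ ψ b) : a = b :=
  Arr.comp_left_cancel (e.isIso_evalForest φ) h.tgt_eq_src h'.tgt_eq_src
    (h.comp_eq.trans h'.comp_eq.symm)

variable [StrictMonoidal C]

theorem Represents.mul (h : e.Represents φ ψ a) (h' : e.Represents φ' ψ' b) :
    e.Represents (φ ++ φ') (ψ ++ ψ') (a * b) where
  leaves_eq := by rw [forestLeaves_append, h.leaves_eq, h'.leaves_eq, forestLeaves_append]
  src_eq := by rw [Arr.mul_src, h.src_eq, h'.src_eq, List.length_append, tensorPow_add]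
  tgt_eq := by rw [Arr.mul_tgt, h.tgt_eq, h'.tgt_eq, List.length_append, tensorPow_add]
  comp_eq := by
    rw [evalForest_append, ← Arr.comp_mul_comp h.tgt_eq_src h'.tgt_eq_src, h.comp_eq, h'.comp_eq,
      evalForest_append]

/-- A fraction may be expanded by a forest. -/
theorem Represents.graft {χ φ₂ ψ₂ : List BinTree} (h : e.Represents φ ψ a)
    (hφ : ForestGraft φ χ φ₂) (hψ : ForestGraft ψ χ ψ₂) : e.Represents φ₂ ψ₂ a where
  leaves_eq := by rw [hφ.leaves_eq, hψ.leaves_eq]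
  src_eq := by rw [h.src_eq, hφ.length_eq']
  tgt_eq := by rw [h.tgt_eq, hψ.length_eq']
  comp_eq := by
    rw [e.evalForest_of_graft hφ, e.evalForest_of_graft hψ, Arr.comp_assoc _ h.tgt_eq_src,
      h.comp_eq]
    rw [evalForest_tgt, evalForest_src, hφ.length_eq]

theorem represents_iso_hom (e : IdempotentObject C) :
    e.Represents [leaf, leaf] [node leaf leaf] ⟨e.iso.hom⟩ where
  leaves_eq := rfl
  src_eq := (tensorPow_two e.obj).symm
  tgt_eq := (tensorPow_one e.obj).symm
  comp_eq := by
    rw [evalForest_cons, evalForest_singleton, evalForest_singleton]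
    rfl

end Represents

/-! ### Strict monoidal functors preserve the evaluation of forests -/

section Functor

variable {C : Type u₁} [Category.{v₁} C] [MonoidalCategory C]
  {D : Type u₂} [Category.{v₂} D] [MonoidalCategory D] {G : C ⥤ D}

theorem map_tensorPow (hG : IsStrictMonoidalFunctor G) (A : C) (n : ℕ) :
    G.obj (tensorPow A n) = tensorPow (G.obj A) n := by
  induction n with
  | zero => exact hG.obj_unit
  | succ n ih => rw [tensorPow, hG.obj_tensor, ih, tensorPow]

theorem map_evalTree (e : IdempotentObject C) (hG : IsStrictMonoidalFunctor G) (t : BinTree) :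
    (e.evalTree t).map G = (e.map G hG).evalTree t := by
  induction t with
  | leaf => simp [evalTree, Arr.map, IdempotentObject.map]
  | node s t ihs iht =>
    rw [evalTree, Arr.map_comp _ (e.evalTree_mul_tgt s t), Arr.map_mul hG, ihs, iht, evalTree]
    congr 1
    simp [Arr.map, IdempotentObject.map]

theorem map_evalForest [StrictMonoidal C] [StrictMonoidal D] (e : IdempotentObject C)
    (hG : IsStrictMonoidalFunctor G) (φ : List BinTree) :
    (e.evalForest φ).map G = (e.map G hG).evalForest φ := by
  induction φ with
  | nil => exact Arr.map_one hG
  | cons t φ ih => rw [evalForest_cons, Arr.map_mul hG, map_evalTree, ih, evalForest_cons]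

theorem Represents.map [StrictMonoidal C] [StrictMonoidal D] {e : IdempotentObject C}
    {φ ψ : List BinTree} {a : Arr C} (h : e.Represents φ ψ a) (hG : IsStrictMonoidalFunctor G) :
    (e.map G hG).Represents φ ψ (a.map G) where
  leaves_eq := h.leaves_eq
  src_eq := (congrArg G.obj h.src_eq).trans (map_tensorPow hG _ _)
  tgt_eq := (congrArg G.obj h.tgt_eq).trans (map_tensorPow hG _ _)
  comp_eq := by
    rw [← map_evalForest, ← Arr.map_comp _ h.tgt_eq_src, h.comp_eq, map_evalForest]

end Functor

theorem ext_of_arr {C : Type u} [Category.{v} C] [MonoidalCategory C] {a b : IdempotentObject C}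
    (h : a.obj = b.obj) (h' : Arr.mk a.iso.hom = Arr.mk b.iso.hom) : a = b := by
  obtain ⟨A, α⟩ := a
  obtain ⟨B, β⟩ := b
  dsimp only at h
  subst h
  congr 1
  exact Iso.ext (Arr.mk_injective h')

end IdempotentObject

/-! ### Dyadic maps between the intervals `[0, n]` -/

/-- The juxtaposition of a map `f : [0, m] → [0, n]` with a map `g`. -/
noncomputable def juxtapose (m n : ℝ) (f g : ℝ → ℝ) : ℝ → ℝ :=
  fun x => if x < m then f x else n + g (x - m)

/-- The map `[0, 2] → [0, 1]`, `x ↦ x / 2`, extended by translations. -/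
noncomputable def halve : ℝ → ℝ :=
  fun x => if x < 0 then x else if x < 2 then x / 2 else x - 1

/-- The map `[0, 1] → [0, 2]`, `x ↦ 2 * x`, extended by translations. -/
noncomputable def double : ℝ → ℝ :=
  fun x => if x < 0 then x else if x < 1 then 2 * x else x + 1

theorem halve_double (x : ℝ) : halve (double x) = x := by
  unfold halve double
  split_ifs <;> linarith

theorem double_halve (x : ℝ) : double (halve x) = x := by
  unfold halve double
  split_ifs <;> linarith

theorem juxtapose_of_lt {m n : ℝ} {f g : ℝ → ℝ} {x : ℝ} (h : x < m) :
    juxtapose m n f g x = f x :=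
  if_pos h

theorem juxtapose_of_le {m n : ℝ} {f g : ℝ → ℝ} {x : ℝ} (h : m ≤ x) :
    juxtapose m n f g x = n + g (x - m) :=
  if_neg h.not_gt

theorem juxtapose_id (m : ℝ) : juxtapose m m id id = id := by
  funext x
  simp [juxtapose]

theorem juxtapose_assoc {m m' n n' : ℝ} (hm : 0 ≤ m') (f g h : ℝ → ℝ) :
    juxtapose (m + m') (n + n') (juxtapose m n f g) h =
      juxtapose m n f (juxtapose m' n' g h) := by
  funext x
  rcases lt_or_ge x m with h₁ | h₁
  · rw [juxtapose_of_lt (by linarith), juxtapose_of_lt h₁, juxtapose_of_lt h₁]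
  rw [juxtapose_of_le h₁]
  rcases lt_or_ge x (m + m') with h₂ | h₂
  · rw [juxtapose_of_lt h₂, juxtapose_of_le h₁, juxtapose_of_lt (by linarith)]
  · rw [juxtapose_of_le h₂, juxtapose_of_le (by linarith), sub_sub, add_assoc]

/-- The maps `[0, m] → [0, n]` that are generated by halving and doubling under composition and
juxtaposition. A map is encoded by its extension to `ℝ` as the identity on the negative numbers and
as a translation on the numbers beyond `m`. -/
inductive DyadicMap : ℕ → ℕ → (ℝ → ℝ) → Prop
  | id (n : ℕ) : DyadicMap n n id
  | halve : DyadicMap 2 1 halve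
  | double : DyadicMap 1 2 double
  | comp {m n p : ℕ} {f g : ℝ → ℝ} : DyadicMap m n f → DyadicMap n p g → DyadicMap m p (g ∘ f)
  | juxtapose {m n m' n' : ℕ} {f g : ℝ → ℝ} : DyadicMap m n f → DyadicMap m' n' g →
      DyadicMap (m + m') (n + n') (juxtapose m n f g)

/-- The normalisation of the extension to `ℝ` of an increasing bijection `[0, m] → [0, n]`. -/
structure IsExtended (m n : ℕ) (f : ℝ → ℝ) : Prop where
  strictMono : StrictMono f
  of_nonpos : ∀ x ≤ 0, f x = x
  of_le : ∀ x : ℝ, m ≤ x → f x = x - m + n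

namespace IsExtended

variable {m n : ℕ} {f : ℝ → ℝ}

theorem map_zero (h : IsExtended m n f) : f 0 = 0 := h.of_nonpos 0 le_rfl

theorem map_end (h : IsExtended m n f) : f m = n := by simpa using h.of_le m le_rfl

theorem nonneg (h : IsExtended m n f) {x : ℝ} (hx : 0 ≤ x) : 0 ≤ f x := by
  simpa [h.map_zero] using h.strictMono.monotone hx

theorem lt_end (h : IsExtended m n f) {x : ℝ} (hx : x < m) : f x < n := by
  simpa [h.map_end] using h.strictMono hx

theorem juxtapose {m' n' : ℕ} {g : ℝ → ℝ} (hf : IsExtended m n f) (hg : IsExtended m' n' g) :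
    IsExtended (m + m') (n + n') (juxtapose m n f g) where
  strictMono := by
    intro x y hxy
    rcases lt_or_ge y m with hy | hy
    · rw [juxtapose_of_lt hy, juxtapose_of_lt (hxy.trans hy)]
      exact hf.strictMono hxy
    rw [juxtapose_of_le hy]
    rcases lt_or_ge x m with hx | hx
    · rw [juxtapose_of_lt hx]
      have h₁ := hf.lt_end hx
      have h₂ := hg.nonneg (sub_nonneg.2 hy)
      linarith
    · rw [juxtapose_of_le hx]
      have := hg.strictMono (sub_lt_sub_right hxy (m : ℝ))
      linarith
  of_nonpos x hx := by
    rcases lt_or_ge x m with h | h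
    · rw [juxtapose_of_lt h, hf.of_nonpos x hx]
    · have hm : (m : ℝ) = 0 := le_antisymm (h.trans hx) (Nat.cast_nonneg m)
      obtain rfl : x = 0 := le_antisymm hx (hm ▸ h)
      have := hf.map_end
      rw [hm, hf.map_zero] at this
      rw [juxtapose_of_le h, hm, sub_zero, hg.map_zero, ← this, add_zero]
  of_le x hx := by
    push_cast at hx ⊢
    have : (0 : ℝ) ≤ m' := Nat.cast_nonneg _
    rw [juxtapose_of_le (by linarith), hg.of_le _ (by linarith)]
    ring

end IsExtended

theorem isExtended_halve : IsExtended 2 1 halve where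
  strictMono x y hxy := by
    unfold halve
    split_ifs <;> linarith
  of_nonpos x hx := by
    unfold halve
    split_ifs <;> linarith
  of_le x hx := by
    push_cast at hx ⊢
    unfold halve
    split_ifs <;> linarith

theorem isExtended_double : IsExtended 1 2 double where
  strictMono x y hxy := by
    unfold double
    split_ifs <;> linarith
  of_nonpos x hx := by
    unfold double
    split_ifs <;> linarith
  of_le x hx := by
    push_cast at hx ⊢
    unfold double
    split_ifs <;> linarith

theorem DyadicMap.isExtended {m n : ℕ} {f : ℝ → ℝ} (h : DyadicMap m n f) : IsExtended m n f := by
  induction h with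
  | id n => exact ⟨strictMono_id, fun _ _ => rfl, fun x _ => by simp⟩
  | halve => exact isExtended_halve
  | double => exact isExtended_double
  | comp _ _ hf hg =>
    refine ⟨hg.strictMono.comp hf.strictMono, fun x hx => ?_, fun x hx => ?_⟩
    · rw [Function.comp_apply, hf.of_nonpos x hx, hg.of_nonpos x hx]
    · rw [Function.comp_apply, hf.of_le x hx, hg.of_le _ (by linarith)]
      ring
  | juxtapose _ _ hf hg => exact hf.juxtapose hg

theorem juxtapose_comp_juxtapose {m n p m' n' : ℕ} {f g f' g' : ℝ → ℝ} (hf : IsExtended m n f)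
    (hf' : IsExtended m' n' f') :
    juxtapose n p g g' ∘ juxtapose m n f f' = juxtapose m p (g ∘ f) (g' ∘ f') := by
  funext x
  rw [Function.comp_apply]
  rcases lt_or_ge x m with h | h
  · rw [juxtapose_of_lt h, juxtapose_of_lt h, juxtapose_of_lt (hf.lt_end h), Function.comp_apply]
  · have := hf'.nonneg (sub_nonneg.2 h)
    rw [juxtapose_of_le h, juxtapose_of_le h, juxtapose_of_le (by linarith), add_sub_cancel_left,
      Function.comp_apply]

theorem juxtapose_zero {f g : ℝ → ℝ} (hf : ∀ x ≤ 0, f x = x) (hg : ∀ x ≤ 0, g x = x) :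
    juxtapose 0 0 f g = g := by
  funext x
  rcases lt_or_ge x 0 with h | h
  · rw [juxtapose_of_lt h, hf x h.le, hg x h.le]
  · rw [juxtapose_of_le h, sub_zero, zero_add]

theorem DyadicMap.exists_inverse {m n : ℕ} {f : ℝ → ℝ} (h : DyadicMap m n f) :
    ∃ g, DyadicMap n m g ∧ g ∘ f = _root_.id ∧ f ∘ g = _root_.id := by
  induction h with
  | id n => exact ⟨_, .id n, rfl, rfl⟩
  | halve => exact ⟨_, .double, funext double_halve, funext halve_double⟩
  | double => exact ⟨_, .halve, funext halve_double, funext double_halve⟩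
  | @comp m n p f g _ _ hf hg =>
    obtain ⟨f', hf', h₁, h₂⟩ := hf
    obtain ⟨g', hg', h₃, h₄⟩ := hg
    refine ⟨f' ∘ g', .comp hg' hf', ?_, ?_⟩
    · rw [Function.comp_assoc, ← Function.comp_assoc g', h₃, Function.id_comp, h₁]
    · rw [Function.comp_assoc, ← Function.comp_assoc f, h₂, Function.id_comp, h₄]
  | juxtapose hf hg ihf ihg =>
    obtain ⟨f', hf', h₁, h₂⟩ := ihf
    obtain ⟨g', hg', h₃, h₄⟩ := ihg
    refine ⟨_, .juxtapose hf' hg', ?_, ?_⟩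
    · rw [juxtapose_comp_juxtapose hf.isExtended hg.isExtended, h₁, h₃, juxtapose_id]
    · rw [juxtapose_comp_juxtapose hf'.isExtended hg'.isExtended, h₂, h₄, juxtapose_id]

/-! ### The strict monoidal category of dyadic maps -/

/-- The objects of the strict monoidal category of dyadic maps: the interval `[0, n]` for each
natural number `n`. The tensor product adds lengths and juxtaposes maps. -/
@[ext]
structure DyadicInterval : Type u where
  length : ℕ

/-- The morphisms `[0, m] ⟶ [0, n]` are the dyadic maps. There are none if exactly one of `m`
and `n` is zero. -/
@[ext]
structure DyadicInterval.Hom (X Y : DyadicInterval.{u}) : Type v where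
  fn : ℝ → ℝ
  dyadicMap : DyadicMap X.length Y.length fn

namespace DyadicInterval

instance : Category.{v} DyadicInterval.{u} where
  Hom := DyadicInterval.Hom
  id X := ⟨id, .id _⟩
  comp f g := ⟨g.fn ∘ f.fn, f.dyadicMap.comp g.dyadicMap⟩

variable {X Y Z X' Y' : DyadicInterval.{u}}

theorem hom_ext {f g : X ⟶ Y} (h : f.fn = g.fn) : f = g := Hom.ext h

theorem isExtended (f : X ⟶ Y) : IsExtended X.length Y.length f.fn := f.dyadicMap.isExtended

@[simp]
theorem id_fn (X : DyadicInterval.{u}) : (𝟙 X : X ⟶ X).fn = id := rfl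

@[simp]
theorem comp_fn (f : X ⟶ Y) (g : Y ⟶ Z) : (f ≫ g).fn = g.fn ∘ f.fn := rfl

@[simp]
theorem eqToHom_fn (h : X = Y) : (eqToHom h).fn = id := by
  subst h
  rfl

noncomputable instance : MonoidalCategoryStruct DyadicInterval.{u} where
  tensorObj X Y := ⟨X.length + Y.length⟩
  tensorUnit := ⟨0⟩
  tensorHom {X₁ Y₁ _ _} f g :=
    ⟨juxtapose X₁.length Y₁.length f.fn g.fn, f.dyadicMap.juxtapose g.dyadicMap⟩
  whiskerLeft X _ _ g := ⟨juxtapose X.length X.length id g.fn, .juxtapose (.id _) g.dyadicMap⟩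
  whiskerRight {X Y} f _ := ⟨juxtapose X.length Y.length f.fn id, f.dyadicMap.juxtapose (.id _)⟩
  associator _ _ _ := eqToIso (DyadicInterval.ext (Nat.add_assoc _ _ _))
  leftUnitor _ := eqToIso (DyadicInterval.ext (Nat.zero_add _))
  rightUnitor _ := eqToIso (DyadicInterval.ext (Nat.add_zero _))

@[simp]
theorem tensor_length (X Y : DyadicInterval.{u}) : (X ⊗ Y).length = X.length + Y.length := rfl

@[simp]
theorem unit_length : (𝟙_ DyadicInterval.{u}).length = 0 := rfl

@[simp]
theorem tensorHom_fn (f : X ⟶ Y) (g : X' ⟶ Y') :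
    (f ⊗ₘ g).fn = juxtapose X.length Y.length f.fn g.fn := rfl

@[simp]
theorem associator_hom_fn (X Y Z : DyadicInterval.{u}) : (α_ X Y Z).hom.fn = id :=
  eqToHom_fn (DyadicInterval.ext (Nat.add_assoc _ _ _))

@[simp]
theorem leftUnitor_hom_fn (X : DyadicInterval.{u}) : (λ_ X).hom.fn = id :=
  eqToHom_fn (DyadicInterval.ext (Nat.zero_add _))

@[simp]
theorem rightUnitor_hom_fn (X : DyadicInterval.{u}) : (ρ_ X).hom.fn = id :=
  eqToHom_fn (DyadicInterval.ext (Nat.add_zero _))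

noncomputable instance : MonoidalCategory DyadicInterval.{u} := .ofTensorHom
  (id_tensorHom_id := fun X Y => hom_ext (juxtapose_id _))
  (id_tensorHom := fun _ _ _ _ => rfl)
  (tensorHom_id := fun _ _ => rfl)
  (tensorHom_comp_tensorHom := fun f f' _ _ =>
    hom_ext (juxtapose_comp_juxtapose (isExtended f) (isExtended f')))
  (associator_naturality := fun f g h => hom_ext <| by
    simpa using juxtapose_assoc (Nat.cast_nonneg _) f.fn g.fn h.fn)
  (leftUnitor_naturality := fun f => hom_ext <| by
    simpa using juxtapose_zero (f := id) (fun _ _ => rfl) (isExtended f).of_nonpos)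
  (rightUnitor_naturality := fun {X Y} f => hom_ext <| by
    simp only [comp_fn, tensorHom_fn, rightUnitor_hom_fn, id_fn, Function.id_comp,
      Function.comp_id]
    funext x
    rcases lt_or_ge x X.length with h | h
    · rw [juxtapose_of_lt h]
    · rw [juxtapose_of_le h, (isExtended f).of_le x h, id, add_comm])
  (pentagon := fun _ _ _ _ => hom_ext <| by simp [juxtapose_id, add_assoc])
  (triangle := fun _ _ => hom_ext <| by simp [juxtapose_id])

instance : StrictMonoidal DyadicInterval.{u} where
  tensor_assoc _ _ _ := DyadicInterval.ext (Nat.add_assoc _ _ _)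
  unit_tensor _ := DyadicInterval.ext (Nat.zero_add _)
  tensor_unit _ := DyadicInterval.ext (Nat.add_zero _)
  associator_eq _ _ _ := rfl
  leftUnitor_eq _ := rfl
  rightUnitor_eq _ := rfl

/-- The unit interval with the halving map `[0, 2] → [0, 1]`. -/
noncomputable def generator : IdempotentObject.{v} DyadicInterval.{u} where
  obj := ⟨1⟩
  iso :=
    { hom := ⟨halve, .halve⟩
      inv := ⟨double, .double⟩
      hom_inv_id := hom_ext (funext double_halve)
      inv_hom_id := hom_ext (funext halve_double) }

theorem tensorPow_generator (n : ℕ) :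
    tensorPow (generator.{v, u}).obj n = ⟨n⟩ := by
  induction n with
  | zero => rfl
  | succ n ih =>
    rw [tensorPow, ih]
    exact DyadicInterval.ext (Nat.add_comm 1 n)

theorem arr_comp_fn {a b : Arr DyadicInterval.{u}} (h : a.tgt = b.src) :
    (a.comp b).hom.fn = b.hom.fn ∘ a.hom.fn := by
  obtain ⟨f⟩ := a
  obtain ⟨g⟩ := b
  dsimp only at h
  subst h
  rw [Arr.mk_comp_mk, comp_fn]

/-- Every morphism of `DyadicInterval` is invertible. -/
noncomputable def isoOfHom (f : X ⟶ Y) : X ≅ Y where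
  hom := f
  inv := ⟨f.dyadicMap.exists_inverse.choose, f.dyadicMap.exists_inverse.choose_spec.1⟩
  hom_inv_id := hom_ext f.dyadicMap.exists_inverse.choose_spec.2.1
  inv_hom_id := hom_ext f.dyadicMap.exists_inverse.choose_spec.2.2

end DyadicInterval

/-! ### Forests as dyadic subdivisions -/

/-- The sum of the lengths `2⁻ᵈ` of dyadic intervals with given depths `d`. -/
noncomputable def totalLength (L : List ℕ) : ℝ := (L.map fun d => (1 : ℝ) / 2 ^ d).sum

@[simp]
theorem totalLength_nil : totalLength [] = 0 := rfl

@[simp]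
theorem totalLength_cons (d : ℕ) (L : List ℕ) :
    totalLength (d :: L) = 1 / 2 ^ d + totalLength L := by
  simp [totalLength]

@[simp]
theorem totalLength_append (L L' : List ℕ) :
    totalLength (L ++ L') = totalLength L + totalLength L' := by
  simp [totalLength]

theorem totalLength_map_add (D : ℕ) (L : List ℕ) :
    totalLength (L.map (D + ·)) = totalLength L / 2 ^ D := by
  induction L with
  | nil => simp
  | cons d L ih =>
    rw [List.map_cons, totalLength_cons, totalLength_cons, ih, pow_add]
    field_simp

theorem totalLength_nonneg (L : List ℕ) : 0 ≤ totalLength L := by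
  induction L with
  | nil => simp
  | cons d L ih =>
    rw [totalLength_cons]
    positivity

/-- The piecewise linear map that sends the intervals `[0, 1], [1, 2], …` to adjacent intervals of
lengths `2⁻ᵈ`, where `d` runs through the list, extended by translations. -/
noncomputable def subdivision : List ℕ → ℝ → ℝ
  | [] => id
  | d :: L => juxtapose 1 (1 / 2 ^ d) (fun x => if x < 0 then x else x / 2 ^ d) (subdivision L)

theorem subdivision_of_nonpos (L : List ℕ) {x : ℝ} (hx : x ≤ 0) : subdivision L x = x := by
  cases L with
  | nil => rfl
  | cons d L =>
    rw [subdivision, juxtapose_of_lt (by linarith)]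
    split_ifs with h
    · rfl
    · rw [le_antisymm hx (not_lt.1 h), zero_div]

theorem subdivision_cons_of_lt (d : ℕ) (L : List ℕ) {x : ℝ} (hx : 0 ≤ x) (hx' : x < 1) :
    subdivision (d :: L) x = x / 2 ^ d := by
  rw [subdivision, juxtapose_of_lt hx', if_neg hx.not_gt]

theorem subdivision_cons_of_le (d : ℕ) (L : List ℕ) {x : ℝ} (hx : 1 ≤ x) :
    subdivision (d :: L) x = 1 / 2 ^ d + subdivision L (x - 1) := by
  rw [subdivision, juxtapose_of_le hx]

theorem subdivision_of_length_le (L : List ℕ) {x : ℝ} (hx : L.length ≤ x) :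
    subdivision L x = x - L.length + totalLength L := by
  induction L generalizing x with
  | nil => simp [subdivision]
  | cons d L ih =>
    rw [List.length_cons] at hx ⊢
    push_cast at hx ⊢
    have : (0 : ℝ) ≤ L.length := Nat.cast_nonneg _
    rw [subdivision_cons_of_le d L (by linarith), ih (by linarith), totalLength_cons]
    ring

theorem subdivision_nonneg (L : List ℕ) {x : ℝ} (hx : 0 ≤ x) : 0 ≤ subdivision L x := by
  induction L generalizing x with
  | nil => exact hx
  | cons d L ih =>
    rcases lt_or_ge x 1 with h | h
    · rw [subdivision_cons_of_lt d L hx h]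
      positivity
    · rw [subdivision_cons_of_le d L h]
      have := ih (sub_nonneg.2 h)
      positivity

theorem subdivision_lt (L : List ℕ) {x : ℝ} (hx : 0 ≤ x) (hx' : x < L.length) :
    subdivision L x < totalLength L := by
  induction L generalizing x with
  | nil => simp at hx'; linarith
  | cons d L ih =>
    rw [List.length_cons] at hx'
    push_cast at hx'
    rw [totalLength_cons]
    rcases lt_or_ge x 1 with h | h
    · rw [subdivision_cons_of_lt d L hx h]
      have : x / 2 ^ d < 1 / 2 ^ d := by gcongr
      linarith [totalLength_nonneg L]
    · rw [subdivision_cons_of_le d L h]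
      linarith [ih (sub_nonneg.2 h) (by linarith)]

theorem subdivision_append (L L' : List ℕ) :
    subdivision (L ++ L') =
      juxtapose L.length (totalLength L) (subdivision L) (subdivision L') := by
  induction L with
  | nil =>
    simpa using (juxtapose_zero (fun _ => subdivision_of_nonpos [])
      (fun _ => subdivision_of_nonpos L')).symm
  | cons d L ih =>
    rw [List.cons_append, subdivision, ih, ← juxtapose_assoc (Nat.cast_nonneg _), List.length_cons,
      totalLength_cons, Nat.cast_succ, add_comm (1 : ℝ)]
    rfl

theorem subdivision_map_succ (L : List ℕ) {x : ℝ} (hx : 0 ≤ x) (hx' : x < L.length) :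
    subdivision (L.map (1 + ·)) x = subdivision L x / 2 := by
  induction L generalizing x with
  | nil => simp at hx'; linarith
  | cons d L ih =>
    rw [List.length_cons] at hx'
    push_cast at hx'
    rw [List.map_cons]
    rcases lt_or_ge x 1 with h | h
    · rw [subdivision_cons_of_lt _ _ hx h, subdivision_cons_of_lt _ _ hx h, pow_add]
      field_simp
    · rw [subdivision_cons_of_le _ _ h, subdivision_cons_of_le _ _ h,
        ih (sub_nonneg.2 h) (by linarith), pow_add]
      field_simp

theorem halve_comp_subdivision {L : List ℕ} (hL : totalLength L = 2) :
    halve ∘ subdivision L = subdivision (L.map (1 + ·)) := by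
  funext x
  rw [Function.comp_apply]
  rcases lt_or_ge x 0 with h | h
  · rw [subdivision_of_nonpos _ h.le, subdivision_of_nonpos _ h.le, halve, if_pos h]
  rcases lt_or_ge x L.length with h' | h'
  · rw [subdivision_map_succ L h h', halve, if_neg (subdivision_nonneg L h).not_gt, if_pos]
    exact hL ▸ subdivision_lt L h h'
  · rw [subdivision_of_length_le L h', subdivision_of_length_le _ (by simpa using h'),
      totalLength_map_add, hL, halve, if_neg (by linarith), if_neg (by linarith), List.length_map]
    ring

/-- A subdivision determines the list of depths. -/
theorem subdivision_injective {L L' : List ℕ} (hL : L.length = L'.length)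
    (h : subdivision L = subdivision L') : L = L' := by
  induction L generalizing L' with
  | nil => exact (List.length_eq_zero_iff.1 hL.symm).symm
  | cons d L ih =>
    obtain _ | ⟨d', L'⟩ := L'
    · simp at hL
    have hd : d = d' := by
      have := congrFun h 1
      rw [subdivision_cons_of_le _ _ le_rfl, subdivision_cons_of_le _ _ le_rfl, sub_self,
        subdivision_of_nonpos L le_rfl, subdivision_of_nonpos L' le_rfl, add_zero, add_zero,
        one_div, one_div, inv_inj] at this
      exact Nat.pow_right_injective le_rfl (by exact_mod_cast this)
    subst hd
    rw [ih (by simpa using hL)]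
    funext y
    rcases lt_or_ge y 0 with hy | hy
    · rw [subdivision_of_nonpos _ hy.le, subdivision_of_nonpos _ hy.le]
    · have := congrFun h (y + 1)
      rwa [subdivision_cons_of_le _ _ (by linarith), subdivision_cons_of_le _ _ (by linarith),
        add_sub_cancel_right, add_right_inj] at this

namespace BinTree

/-- The list of the depths of the leaves of a tree, from left to right. -/
def depths : BinTree → List ℕ
  | leaf => [0]
  | node s t => (s.depths ++ t.depths).map (1 + ·)

/-- The list of the depths of the leaves of a forest. -/
def forestDepths (φ : List BinTree) : List ℕ := φ.flatMap depths

@[simp]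
theorem length_depths (t : BinTree) : t.depths.length = t.leaves := by
  induction t with
  | leaf => rfl
  | node s t ihs iht => simp [depths, leaves, ihs, iht]

theorem length_forestDepths (φ : List BinTree) : (forestDepths φ).length = forestLeaves φ := by
  simp [forestDepths, forestLeaves, List.length_flatMap]

@[simp]
theorem totalLength_depths (t : BinTree) : totalLength t.depths = 1 := by
  induction t with
  | leaf => simp [depths]
  | node s t ihs iht =>
    rw [depths, totalLength_map_add, totalLength_append, ihs, iht]
    norm_num

theorem exists_depths_eq_cons (t : BinTree) : ∃ d L, t.depths = d :: L := by
  induction t with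
  | leaf => exact ⟨_, _, rfl⟩
  | node s t ihs iht =>
    obtain ⟨d, L, h⟩ := ihs
    exact ⟨1 + d, _, by rw [depths, h]; rfl⟩

theorem map_depths_node (D : ℕ) (s t : BinTree) :
    (node s t).depths.map (D + ·) = s.depths.map (D + 1 + ·) ++ t.depths.map (D + 1 + ·) := by
  simp [depths, Function.comp_def, Nat.add_assoc]

/-- A tree can be read off from any list that starts with the depths of its leaves. -/
theorem depths_append_injective (s : BinTree) : ∀ (t : BinTree) (D : ℕ) {L L' : List ℕ},
    s.depths.map (D + ·) ++ L = t.depths.map (D + ·) ++ L' → s = t ∧ L = L' := by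
  induction s with
  | leaf =>
    rintro (_ | ⟨t, t'⟩) D L L' h
    · exact ⟨rfl, by simpa using h⟩
    · obtain ⟨d, K, hd⟩ := exists_depths_eq_cons t
      rw [map_depths_node, hd] at h
      simp [depths] at h
      omega
  | node s s' ih ih' =>
    rintro (_ | ⟨t, t'⟩) D L L' h
    · obtain ⟨d, K, hd⟩ := exists_depths_eq_cons s
      rw [map_depths_node, hd] at h
      simp [depths] at h
      omega
    · rw [map_depths_node, map_depths_node, List.append_assoc, List.append_assoc] at h
      obtain ⟨rfl, h₁⟩ := ih _ (D + 1) h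
      obtain ⟨rfl, h₂⟩ := ih' _ (D + 1) h₁
      exact ⟨rfl, h₂⟩

theorem forestDepths_injective {φ ψ : List BinTree} (h : φ.length = ψ.length)
    (h' : forestDepths φ = forestDepths ψ) : φ = ψ := by
  induction φ generalizing ψ with
  | nil => exact (List.length_eq_zero_iff.1 h.symm).symm
  | cons s φ ih =>
    obtain _ | ⟨t, ψ⟩ := ψ
    · simp at h
    obtain ⟨rfl, hL⟩ := depths_append_injective s t 0 (L := forestDepths φ) (L' := forestDepths ψ)
      (by simpa [forestDepths] using h')
    rw [ih (by simpa using h) hL]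

end BinTree

namespace DyadicInterval

theorem evalTree_src_length (t : BinTree) :
    ((generator.{v, u}).evalTree t).src.length = t.leaves := by
  rw [IdempotentObject.evalTree_src, tensorPow_generator]

theorem evalTree_fn (t : BinTree) :
    ((generator.{v, u}).evalTree t).hom.fn = subdivision t.depths := by
  induction t with
  | leaf =>
    funext x
    simp only [IdempotentObject.evalTree, id_fn, depths, subdivision, juxtapose]
    split_ifs <;> simp
  | node s t ihs iht =>
    rw [IdempotentObject.evalTree, arr_comp_fn (IdempotentObject.evalTree_mul_tgt _ s t)]
    change halve ∘ juxtapose _ _ _ _ = _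
    rw [ihs, iht, evalTree_src_length, IdempotentObject.evalTree_tgt, depths,
      ← halve_comp_subdivision, subdivision_append, length_depths, totalLength_depths]
    · simp [generator]
    · rw [totalLength_append, totalLength_depths, totalLength_depths]
      norm_num

theorem evalForest_fn (φ : List BinTree) :
    ((generator.{v, u}).evalForest φ).hom.fn = subdivision (forestDepths φ) := by
  induction φ with
  | nil => rfl
  | cons t φ ih =>
    rw [IdempotentObject.evalForest_cons]
    change juxtapose _ _ _ _ = _
    rw [ih, evalTree_fn, evalTree_src_length, IdempotentObject.evalTree_tgt,
      show forestDepths (t :: φ) = t.depths ++ forestDepths φ from List.flatMap_cons,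
      subdivision_append, length_depths, totalLength_depths]
    simp [generator]

/-- Distinct forests prescribe distinct dyadic maps. -/
theorem evalForest_injective {φ ψ : List BinTree}
    (h : (generator.{v, u}).evalForest φ = generator.evalForest ψ) : φ = ψ := by
  have h₁ := congrArg (fun a => a.src.length) h
  have h₂ := congrArg (fun a => a.tgt.length) h
  have h₃ := congrArg (fun a => a.hom.fn) h
  simp only [IdempotentObject.evalForest_src, IdempotentObject.evalForest_tgt,
    tensorPow_generator, evalForest_fn] at h₁ h₂ h₃
  refine forestDepths_injective h₂ (subdivision_injective ?_ h₃)
  rw [length_forestDepths, length_forestDepths, h₁]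

end DyadicInterval

/-! ### The universal property -/

namespace DyadicInterval

open IdempotentObject

variable {D : Type u₂} [Category.{v₂} D] [MonoidalCategory D] {e : IdempotentObject D}

/-- The arrow `d` between tensor powers of the idempotent object corresponds to the dyadic map `a`
if both are the same fraction of forests. -/
def Corresponds (e : IdempotentObject D) (a : Arr.{v} DyadicInterval.{u}) (d : Arr D) : Prop :=
  ∃ φ ψ, (generator.{v, u}).Represents φ ψ a ∧ e.Represents φ ψ d

theorem Corresponds.src_eq {a : Arr.{v} DyadicInterval.{u}} {d : Arr D}
    (h : Corresponds.{v} e a d) : d.src = tensorPow e.obj a.src.length := by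
  obtain ⟨φ, ψ, h, h'⟩ := h
  rw [h.src_eq, h'.src_eq, tensorPow_generator]

theorem Corresponds.tgt_eq {a : Arr.{v} DyadicInterval.{u}} {d : Arr D}
    (h : Corresponds.{v} e a d) : d.tgt = tensorPow e.obj a.tgt.length := by
  obtain ⟨φ, ψ, h, h'⟩ := h
  rw [h.tgt_eq, h'.tgt_eq, tensorPow_generator]

theorem corresponds_id (e : IdempotentObject D) (n : ℕ) :
    Corresponds.{v} e ⟨𝟙 (⟨n⟩ : DyadicInterval.{u})⟩ ⟨𝟙 (tensorPow e.obj n)⟩ := by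
  have h := Represents.id (generator.{v, u}) (List.replicate n leaf)
  have h' := Represents.id e (List.replicate n leaf)
  rw [List.length_replicate] at h h'
  rw [tensorPow_generator] at h
  exact ⟨_, _, h, h'⟩

variable [StrictMonoidal D]

/-- Two fractions for the same dyadic map acquire the same denominator after expansion; then their
numerators prescribe the same dyadic map, so they are equal. -/
theorem Corresponds.unique {a : Arr.{v} DyadicInterval.{u}} {d d' : Arr D}
    (h : Corresponds.{v} e a d) (h' : Corresponds.{v} e a d') : d = d' := by
  obtain ⟨φ, ψ, ha, hd⟩ := h
  obtain ⟨φ', ψ', ha', hd'⟩ := h'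
  have hlen : φ.length = φ'.length := by
    simpa [tensorPow_generator] using congrArg length (ha.src_eq.symm.trans ha'.src_eq)
  obtain ⟨χ, χ', ω, hω, hω'⟩ := exists_common_forestGraft φ hlen
  obtain ⟨ρ, hρ⟩ := exists_forestGraft ψ (hω.length_eq.trans ha.leaves_eq)
  obtain ⟨ρ', hρ'⟩ := exists_forestGraft ψ' (hω'.length_eq.trans ha'.leaves_eq)
  obtain rfl : ρ = ρ' := evalForest_injective
    ((ha.graft hω hρ).comp_eq.symm.trans (ha'.graft hω' hρ').comp_eq)
  exact (hd.graft hω hρ).unique (hd'.graft hω' hρ')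

theorem corresponds_halve (e : IdempotentObject D) :
    Corresponds.{v} e ⟨(generator.{v, u}).iso.hom⟩ ⟨e.iso.hom⟩ :=
  ⟨_, _, generator.represents_iso_hom, e.represents_iso_hom⟩

theorem corresponds_double (e : IdempotentObject D) :
    Corresponds.{v} e ⟨(generator.{v, u}).iso.inv⟩ ⟨e.iso.inv⟩ :=
  ⟨_, _, generator.represents_iso_hom.inv, e.represents_iso_hom.inv⟩

theorem Corresponds.mul {a b : Arr.{v} DyadicInterval.{u}} {c d : Arr D}
    (h : Corresponds.{v} e a c) (h' : Corresponds.{v} e b d) :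
    Corresponds.{v} e (a * b) (c * d) := by
  obtain ⟨φ, ψ, ha, hc⟩ := h
  obtain ⟨φ', ψ', hb, hd⟩ := h'
  exact ⟨_, _, ha.mul hb, hc.mul hd⟩

theorem Corresponds.comp {a b : Arr.{v} DyadicInterval.{u}} {c d : Arr D}
    (h : Corresponds.{v} e a c) (h' : Corresponds.{v} e b d) (hab : a.tgt = b.src) :
    Corresponds.{v} e (a.comp b) (c.comp d) := by
  obtain ⟨φ, ψ, ha, hc⟩ := h
  obtain ⟨φ', ψ', hb, hd⟩ := h'
  have hlen : ψ.length = φ'.length := by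
    simpa [tensorPow_generator] using congrArg length (ha.tgt_eq.symm.trans (hab.trans hb.src_eq))
  obtain ⟨χ, χ', ω, hω, hω'⟩ := exists_common_forestGraft ψ hlen
  obtain ⟨ρ, hρ⟩ := exists_forestGraft φ (hω.length_eq.trans ha.leaves_eq.symm)
  obtain ⟨ρ', hρ'⟩ := exists_forestGraft ψ' (hω'.length_eq.trans hb.leaves_eq)
  exact ⟨ρ, ρ', (ha.graft hρ hω).comp (hb.graft hω' hρ'), (hc.graft hρ hω).comp (hd.graft hω' hρ')⟩

/-- The morphism given by a dyadic map. -/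
def homOf {m n : ℕ} {f : ℝ → ℝ} (h : DyadicMap m n f) :
    DyadicInterval.Hom.{v} (⟨m⟩ : DyadicInterval.{u}) ⟨n⟩ :=
  ⟨f, h⟩

theorem exists_corresponds_homOf (e : IdempotentObject D) {m n : ℕ} {f : ℝ → ℝ}
    (h : DyadicMap m n f) : ∃ d : Arr D, Corresponds.{v} e ⟨homOf.{v, u} h⟩ d := by
  induction h with
  | id n => exact ⟨_, corresponds_id e n⟩
  | halve => exact ⟨_, corresponds_halve e⟩
  | double => exact ⟨_, corresponds_double e⟩
  | comp hf hg ihf ihg =>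
    obtain ⟨c, hc⟩ := ihf
    obtain ⟨d, hd⟩ := ihg
    have := hc.comp hd rfl
    rw [Arr.mk_comp_mk] at this
    exact ⟨_, this⟩
  | juxtapose hf hg ihf ihg =>
    obtain ⟨c, hc⟩ := ihf
    obtain ⟨d, hd⟩ := ihg
    exact ⟨_, hc.mul hd⟩

theorem exists_corresponds (e : IdempotentObject D) {X Y : DyadicInterval.{u}} (f : X ⟶ Y) :
    ∃ d : tensorPow e.obj X.length ⟶ tensorPow e.obj Y.length, Corresponds.{v} e ⟨f⟩ ⟨d⟩ := by
  obtain ⟨⟨d⟩, hd⟩ := exists_corresponds_homOf.{v, u} e f.dyadicMap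
  obtain rfl := hd.src_eq
  obtain rfl := hd.tgt_eq
  exact ⟨d, hd⟩

variable (e)

/-- The functor that sends a fraction of forests to the same fraction in `D`. -/
noncomputable def lift : Functor.{v} DyadicInterval.{u} D where
  obj X := tensorPow e.obj X.length
  map f := (exists_corresponds.{v} e f).choose
  map_id X := Arr.mk_injective <|
    (exists_corresponds.{v} e (𝟙 X)).choose_spec.unique (corresponds_id e X.length)
  map_comp f g := Arr.mk_injective <| by
    have := (exists_corresponds e f).choose_spec.comp (exists_corresponds e g).choose_spec rfl
    rw [Arr.mk_comp_mk, Arr.mk_comp_mk] at this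
    exact (exists_corresponds e (f ≫ g)).choose_spec.unique this

theorem corresponds_lift {X Y : DyadicInterval.{u}} (f : X ⟶ Y) :
    Corresponds.{v} e ⟨f⟩ ⟨(lift.{v} e).map f⟩ :=
  (exists_corresponds.{v} e f).choose_spec

theorem isStrictMonoidalFunctor_lift : IsStrictMonoidalFunctor (lift.{v, u} e) where
  obj_unit := rfl
  obj_tensor X Y := tensorPow_add e.obj X.length Y.length
  map_tensor {X X' Y Y'} f g := Arr.eq_of_mk_eq ((corresponds_lift e (f ⊗ₘ g)).unique
    ((corresponds_lift e f).mul (corresponds_lift e g)))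
    (tensorPow_add e.obj X.length Y.length) (tensorPow_add e.obj X'.length Y'.length)

theorem generator_map_lift :
    (generator.{v, u}).map (lift e) (isStrictMonoidalFunctor_lift e) = e := by
  refine ext_of_arr (tensorPow_one e.obj) ?_
  simp only [IdempotentObject.map, Iso.trans_hom, eqToIso.hom, Functor.mapIso_hom,
    Arr.mk_eqToHom_comp]
  exact (corresponds_lift e _).unique (corresponds_halve e)

variable {e}

theorem eq_lift {G : Functor.{v} DyadicInterval.{u} D} (hG : IsStrictMonoidalFunctor G)
    (h : (generator.{v, u}).map G hG = e) : G = lift e := by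
  have hobj : ∀ X, G.obj X = (lift.{v} e).obj X := by
    intro X
    have := IdempotentObject.map_tensorPow hG (generator.{v, u}).obj X.length
    rw [tensorPow_generator] at this
    rw [this, ← h]
    rfl
  refine CategoryTheory.Functor.ext hobj fun X Y f => ?_
  refine Arr.eq_of_mk_eq ?_ (hobj X) (hobj Y)
  obtain ⟨φ, ψ, hf, -⟩ := corresponds_lift e f
  have hGf := hf.map hG
  rw [h] at hGf
  exact Corresponds.unique ⟨φ, ψ, hf, hGf⟩ (corresponds_lift e f)

theorem isFreelyGeneratedBy_generator :
    IsFreelyGeneratedBy.{v} DyadicInterval.{u} (generator.{v, u}) := by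
  intro D _ _ _ e
  exact ⟨lift e, ⟨isStrictMonoidalFunctor_lift e, generator_map_lift e⟩,
    fun G ⟨hG, h⟩ => eq_lift hG h⟩

end DyadicInterval

/-! ### Trees from subdivisions into standard dyadic intervals -/

/-- The adjacent intervals of lengths `2⁻ᵈ`, for `d` in the list, of which the first one starts at
`p`, are standard dyadic intervals `[c / 2 ^ d, (c + 1) / 2 ^ d]`. -/
def IsAligned : ℝ → List ℕ → Prop
  | _, [] => True
  | p, d :: L => (∃ c : ℤ, p = c / 2 ^ d) ∧ IsAligned (p + 1 / 2 ^ d) L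

/-- A sequence of adjacent standard dyadic intervals that starts at the left end of a standard
dyadic interval `I` with an interval contained in `I`, and that is at least as long as `I`, has an
initial segment that subdivides `I` according to a tree: unless the first interval is `I` itself,
an initial segment subdivides the left half of `I`, and the next interval starts at the midpoint,
which forces it to be contained in the right half. -/
theorem exists_tree_of_isAligned (E : ℕ) : ∀ {D : ℕ} {L : List ℕ} {p : ℝ},
    (∀ d ∈ L, d ≤ D + E) → (∃ c : ℤ, p = c / 2 ^ D) → IsAligned p L → (∀ d ∈ L.head?, D ≤ d) →
    1 / 2 ^ D ≤ totalLength L →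
    ∃ (t : BinTree) (L' : List ℕ),
      L = t.depths.map (D + ·) ++ L' ∧ IsAligned (p + 1 / 2 ^ D) L' := by
  induction E with
  | zero =>
    rintro D (_ | ⟨d, L⟩) p hE hp hL hhead htot
    · have : (0 : ℝ) < 1 / 2 ^ D := by positivity
      rw [totalLength_nil] at htot
      linarith
    · obtain rfl : d = D := le_antisymm (hE d (by simp)) (hhead d (by simp))
      exact ⟨leaf, L, by simp [depths], hL.2⟩
  | succ E ih =>
    rintro D (_ | ⟨d, L⟩) p hE hp hL hhead htot
    · have : (0 : ℝ) < 1 / 2 ^ D := by positivity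
      rw [totalLength_nil] at htot
      linarith
    rcases eq_or_lt_of_le (hhead d (by simp)) with rfl | hd
    · exact ⟨leaf, L, by simp [depths], hL.2⟩
    have hhalf : (1 : ℝ) / 2 ^ D = 1 / 2 ^ (D + 1) + 1 / 2 ^ (D + 1) := by
      rw [pow_succ]
      field_simp
      norm_num
    have hpos : (0 : ℝ) < 1 / 2 ^ (D + 1) := by positivity
    obtain ⟨c, hc⟩ := hp
    obtain ⟨s, L₁, hs, hL₁⟩ := ih (D := D + 1) (L := d :: L) (p := p)
      (fun x hx => (hE x hx).trans (by omega))
      ⟨2 * c, by rw [hc, pow_succ]; push_cast; field_simp⟩ hL (by simpa using hd) (by linarith)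
    have hmid : p + 1 / 2 ^ (D + 1) = ((2 * c + 1 : ℤ) : ℝ) / 2 ^ (D + 1) := by
      rw [hc, pow_succ]
      push_cast
      field_simp
    have htot₁ : 1 / 2 ^ (D + 1) ≤ totalLength L₁ := by
      rw [hs, totalLength_append, totalLength_map_add, totalLength_depths] at htot
      linarith
    have hhead₁ : ∀ d ∈ L₁.head?, D + 1 ≤ d := by
      obtain _ | ⟨d', L₁⟩ := L₁
      · simp
      obtain ⟨⟨c', hc'⟩, -⟩ := hL₁
      simp only [List.head?_cons, Option.mem_def, Option.some.injEq, forall_eq']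
      -- Otherwise `2 * c + 1`, the numerator of the midpoint, would be even.
      by_contra! hlt
      obtain ⟨k, rfl⟩ : ∃ k, D = d' + k := ⟨D - d', by omega⟩
      rw [hmid, pow_succ, pow_add] at hc'
      have h2 : ((2 * c + 1 : ℤ) : ℝ) = ((c' * 2 ^ k * 2 : ℤ) : ℝ) := by
        push_cast at hc' ⊢
        field_simp at hc'
        linarith
      have := Int.cast_injective h2
      omega
    obtain ⟨t, L₂, ht, hL₂⟩ := ih (D := D + 1) (L := L₁) (p := p + 1 / 2 ^ (D + 1))
      (fun x hx => (hE x (by rw [hs]; simp [hx])).trans (by omega)) ⟨_, hmid⟩ hL₁ hhead₁ htot₁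
    refine ⟨node s t, L₂, ?_, ?_⟩
    · rw [hs, ht, map_depths_node, List.append_assoc]
    · rwa [hhalf, ← add_assoc]

/-- If `h` maps the intervals `[0, 1], …, [M - 1, M]` affinely onto standard dyadic intervals that
subdivide `[0, 1]`, then `h` is the subdivision of a tree. -/
theorem exists_tree_eq_subdivision {M : ℕ} {h : ℝ → ℝ} {d : ℕ → ℕ} (h0 : h 0 = 0) (hM : h M = 1)
    (hd : ∀ i < M, (∃ c : ℤ, h i = c / 2 ^ d i) ∧
      ∀ s : ℝ, 0 ≤ s → s ≤ 1 → h (i + s) = h i + s / 2 ^ d i) :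
    ∃ t : BinTree, t.leaves = M ∧ ∀ x : ℝ, 0 ≤ x → x < M → subdivision t.depths x = h x := by
  have hstep : ∀ i < M, h ((i + 1 : ℕ) : ℝ) = h i + 1 / 2 ^ d i := fun i hi => by
    simpa using (hd i hi).2 1 zero_le_one le_rfl
  have haligned : ∀ k i, i + k ≤ M → IsAligned (h i) ((List.range' i k).map d) := by
    intro k
    induction k with
    | zero => exact fun _ _ => trivial
    | succ k ih =>
      intro i hik
      refine ⟨(hd i (by omega)).1, ?_⟩
      rw [← hstep i (by omega)]
      exact ih (i + 1) (by omega)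
  have htotal : ∀ k i, i + k ≤ M →
      totalLength ((List.range' i k).map d) = h ((i + k : ℕ) : ℝ) - h i := by
    intro k
    induction k with
    | zero => simp
    | succ k ih =>
      intro i hik
      rw [List.range'_succ, List.map_cons, totalLength_cons, ih (i + 1) (by omega),
        hstep i (by omega), show i + 1 + k = i + (k + 1) by omega]
      ring
  have hsub : ∀ k i, i + k ≤ M → ∀ x : ℝ, 0 ≤ x → x < k →
      subdivision ((List.range' i k).map d) x = h (i + x) - h i := by
    intro k
    induction k with
    | zero =>
      intro i _ x hx hx'
      push_cast at hx'
      linarith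
    | succ k ih =>
      intro i hik x hx hx'
      push_cast at hx'
      rw [List.range'_succ, List.map_cons]
      rcases lt_or_ge x 1 with h1 | h1
      · rw [subdivision_cons_of_lt _ _ hx h1, (hd i (by omega)).2 x hx h1.le]
        ring
      · rw [subdivision_cons_of_le _ _ h1, ih (i + 1) (by omega) _ (by linarith) (by linarith),
          hstep i (by omega)]
        push_cast
        rw [show (i : ℝ) + 1 + (x - 1) = i + x by ring]
        ring
  have htot := htotal M 0 (by omega)
  rw [Nat.zero_add, Nat.cast_zero, h0, hM, sub_zero] at htot
  have hal := haligned M 0 (by omega)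
  rw [Nat.cast_zero, h0] at hal
  obtain ⟨t, L', ht, -⟩ := exists_tree_of_isAligned ((List.range' 0 M).map d).sum
    (D := 0) (L := (List.range' 0 M).map d) (p := 0)
    (fun x hx => by simpa using List.single_le_sum (by simp) x hx)
    ⟨0, by simp⟩ hal (by simp) (by rw [htot]; simp)
  obtain rfl : L' = [] := by
    rw [ht, totalLength_append, totalLength_map_add, totalLength_depths] at htot
    obtain _ | ⟨a, L'⟩ := L'
    · rfl
    · rw [totalLength_cons] at htot
      have := totalLength_nonneg L'
      have : (0 : ℝ) < 1 / 2 ^ a := by positivity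
      rw [pow_zero, div_one] at htot
      linarith
  have ht' : (List.range' 0 M).map d = t.depths := by simpa using ht
  refine ⟨t, ?_, fun x hx hx' => ?_⟩
  · rw [← length_depths, ← ht']
    simp
  · rw [← ht', hsub M 0 (by omega) x hx hx', Nat.cast_zero, zero_add, h0, sub_zero]

theorem dyadicMap_subdivision (t : BinTree) : DyadicMap t.leaves 1 (subdivision t.depths) := by
  have := ((DyadicInterval.generator.{0, 0}).evalTree t).hom.dyadicMap
  rwa [DyadicInterval.evalTree_fn, DyadicInterval.evalTree_src_length,
    IdempotentObject.evalTree_tgt] at this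

theorem exists_subdivision_add (L : List ℕ) : ∀ {i : ℕ}, i < L.length →
    ∃ d : ℕ, ∀ r : ℝ, 0 ≤ r → r ≤ 1 → subdivision L (i + r) = subdivision L i + r / 2 ^ d := by
  induction L with
  | nil => simp
  | cons d L ih =>
    rintro (_ | i) hi
    · refine ⟨d, fun r hr hr' => ?_⟩
      rw [Nat.cast_zero, zero_add, subdivision_of_nonpos _ le_rfl, zero_add]
      rcases lt_or_eq_of_le hr' with h | rfl
      · rw [subdivision_cons_of_lt _ _ hr h]
      · rw [subdivision_cons_of_le _ _ le_rfl, sub_self, subdivision_of_nonpos _ le_rfl, add_zero]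
    · obtain ⟨d', hd'⟩ := ih (Nat.lt_of_succ_lt_succ hi)
      refine ⟨d', fun r hr hr' => ?_⟩
      have hi0 : (0 : ℝ) ≤ i := Nat.cast_nonneg i
      push_cast
      rw [subdivision_cons_of_le _ _ (by linarith), subdivision_cons_of_le _ _ (by linarith),
        add_sub_cancel_right, show (i : ℝ) + 1 + r - 1 = i + r by ring, hd' r hr hr']
      ring

theorem isDyadic_subdivision (L : List ℕ) : ∀ {i : ℕ}, i ≤ L.length →
    IsDyadic (subdivision L i) := by
  intro i
  induction i with
  | zero => exact fun _ => ⟨0, 0, by simp [subdivision_of_nonpos]⟩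
  | succ i ih =>
    intro hi
    obtain ⟨d, hd⟩ := exists_subdivision_add L hi
    push_cast
    rw [hd 1 zero_le_one le_rfl]
    exact (ih (by omega)).add ⟨1, d, by simp⟩

/-! ### Thompson's group as a group of dyadic maps -/

open Classical in
/-- The extension of a permutation of `[0, 1]` to `ℝ` by the identity. -/
noncomputable def extendPerm (g : Equiv.Perm unitInterval) : ℝ → ℝ :=
  fun x => if h : x ∈ unitInterval then g ⟨x, h⟩ else x

@[simp]
theorem extendPerm_coe (g : Equiv.Perm unitInterval) (x : unitInterval) :
    extendPerm g x = g x := by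
  simp [extendPerm]

theorem extendPerm_of_notMem (g : Equiv.Perm unitInterval) {x : ℝ} (h : x ∉ unitInterval) :
    extendPerm g x = x :=
  dif_neg h

theorem extendPerm_one : extendPerm 1 = id := by
  funext x
  by_cases h : x ∈ unitInterval
  · lift x to unitInterval using h
    simp
  · exact extendPerm_of_notMem _ h

theorem extendPerm_mul (g h : Equiv.Perm unitInterval) :
    extendPerm (g * h) = extendPerm g ∘ extendPerm h := by
  funext x
  by_cases hx : x ∈ unitInterval
  · lift x to unitInterval using hx
    simp
  · simp [extendPerm_of_notMem _ hx]

theorem extendPerm_injective : Function.Injective extendPerm := by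
  intro g h hgh
  ext x
  rw [← extendPerm_coe, hgh, extendPerm_coe]

theorem map_zero_of_strictMono {g : Equiv.Perm unitInterval} (hg : StrictMono g) : g 0 = 0 := by
  obtain ⟨x, hx⟩ := g.surjective 0
  exact le_antisymm (by simpa [hx] using hg.monotone (unitInterval.nonneg' (t := x)))
    unitInterval.nonneg'

theorem map_one_of_strictMono {g : Equiv.Perm unitInterval} (hg : StrictMono g) : g 1 = 1 := by
  obtain ⟨x, hx⟩ := g.surjective 1
  exact le_antisymm unitInterval.le_one'
    (by simpa [hx] using hg.monotone (unitInterval.le_one' (t := x)))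

/-- On a sufficiently fine uniform dyadic subdivision of `[0, 1]`, a dyadic piecewise linear
bijection maps each interval affinely onto a standard dyadic interval. -/
theorem IsDyadicPL.exists_uniform_subdivision {g : Equiv.Perm unitInterval} (hg : IsDyadicPL g) :
    ∃ (N : ℕ) (d : ℕ → ℕ), ∀ i : ℕ, i < 2 ^ N →
      (∃ c : ℤ, extendPerm g (i / 2 ^ N) = c / 2 ^ d i) ∧
      ∀ s : ℝ, 0 ≤ s → s ≤ 1 →
        extendPerm g ((i + s) / 2 ^ N) = extendPerm g (i / 2 ^ N) + s / 2 ^ d i := by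
  obtain ⟨S, h0, h1, hdy, hS⟩ := hg
  have hgrid : ∀ᶠ N : ℕ in Filter.atTop, ∀ s ∈ S, ∃ c : ℤ, (s : ℝ) = c / 2 ^ N := by
    refine (Filter.eventually_all_finset S).2 fun s hs => ?_
    obtain ⟨⟨c, n, hc⟩, -⟩ := hdy s hs
    refine Filter.eventually_atTop.2 ⟨n, fun N hN => ?_⟩
    obtain ⟨k, rfl⟩ := Nat.exists_eq_add_of_le hN
    exact ⟨c * 2 ^ k, by rw [hc, pow_add]; push_cast; field_simp⟩
  have hslope : ∀ᶠ N : ℕ in Filter.atTop, ∀ a ∈ S, ∀ b ∈ S, a < b →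
      (∀ s ∈ S, ¬ (a < s ∧ s < b)) → ∃ d : ℕ, (∃ c : ℤ, (g a : ℝ) = c / 2 ^ d) ∧
        ∀ x : unitInterval, a ≤ x → x ≤ b →
          (g x : ℝ) = g a + 2 ^ N / 2 ^ d * ((x : ℝ) - a) := by
    refine (Filter.eventually_all_finset S).2 fun a ha =>
      (Filter.eventually_all_finset S).2 fun b hb => ?_
    by_cases hab : a < b ∧ ∀ s ∈ S, ¬ (a < s ∧ s < b)
    · obtain ⟨k, hk⟩ := hS a ha b hb hab.1 hab.2
      obtain ⟨-, c, n, hc⟩ := hdy a ha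
      -- The slope `2 ^ k` sends intervals of length `2⁻ᴺ` to intervals of length `2⁻⁽ᴺ⁻ᵏ⁾`, and
      -- `g a` has denominator `2 ^ n`; this bound ensures `n ≤ N - k`.
      refine Filter.eventually_atTop.2 ⟨n + k.natAbs, fun N hN _ _ => ?_⟩
      obtain ⟨m, hm⟩ : ∃ m : ℕ, (N : ℤ) - k = n + m := ⟨(N - k - n).toNat, by omega⟩
      refine ⟨n + m, ⟨c * 2 ^ m, by rw [hc, pow_add]; push_cast; field_simp⟩, fun x hx hx' => ?_⟩
      have : (2 : ℝ) ^ k = 2 ^ N / 2 ^ (n + m) := by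
        rw [show k = (N : ℤ) - ((n + m : ℕ) : ℤ) by push_cast; omega,
          zpow_sub₀ two_ne_zero, zpow_natCast, zpow_natCast]
      rw [hk x hx hx', this]
    · exact Filter.Eventually.of_forall fun N h h' => absurd ⟨h, h'⟩ hab
  obtain ⟨N, hN, hN'⟩ := (hgrid.and hslope).exists
  have hpow : (0 : ℝ) < 2 ^ N := by positivity
  refine ⟨N, ?_⟩
  suffices h : ∀ i : ℕ, i < 2 ^ N → ∃ d : ℕ, (∃ c : ℤ, extendPerm g (i / 2 ^ N) = c / 2 ^ d) ∧
      ∀ s : ℝ, 0 ≤ s → s ≤ 1 →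
        extendPerm g ((i + s) / 2 ^ N) = extendPerm g (i / 2 ^ N) + s / 2 ^ d by
    choose! d hd using h
    exact ⟨d, hd⟩
  intro i hi
  have hi' : (i : ℝ) + 1 ≤ 2 ^ N := by exact_mod_cast hi
  have hmem : ∀ s : ℝ, 0 ≤ s → s ≤ 1 → ((i : ℝ) + s) / 2 ^ N ∈ unitInterval := fun s hs hs' =>
    ⟨by positivity, (div_le_one hpow).2 (by linarith)⟩
  have hlt : (⟨_, hmem 0 le_rfl zero_le_one⟩ : unitInterval) < ⟨_, hmem 1 zero_le_one le_rfl⟩ := by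
    rw [Subtype.mk_lt_mk]
    gcongr
    norm_num
  obtain ⟨a, ha, b, hb, hax, hyb, hab, hc⟩ := exists_consecutive S h0 h1 hlt (by
    rintro s hs ⟨h, h'⟩
    obtain ⟨c, hc⟩ := hN s hs
    rw [← Subtype.coe_lt_coe, hc, div_lt_div_iff_of_pos_right hpow] at h h'
    have h₁ : (i : ℤ) < c := by
      rw [← Int.cast_lt (R := ℝ)]
      simpa using h
    have h₂ : c < (i : ℤ) + 1 := by
      rw [← Int.cast_lt (R := ℝ)]
      simpa using h'
    omega)
  obtain ⟨d, ⟨c, hgc⟩, hd⟩ := hN' a ha b hb hab hc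
  obtain ⟨c', hac⟩ := hN a ha
  rw [← Subtype.coe_le_coe] at hax hyb
  have key : ∀ s : ℝ, 0 ≤ s → s ≤ 1 →
      extendPerm g (((i : ℝ) + s) / 2 ^ N) = (c + (i + s - c')) / 2 ^ d := by
    intro s hs hs'
    have hx := hd ⟨_, hmem s hs hs'⟩
      (by
        rw [← Subtype.coe_le_coe]
        refine hax.trans ?_
        dsimp only
        gcongr)
      (by
        rw [← Subtype.coe_le_coe]
        refine le_trans ?_ hyb
        dsimp only
        gcongr)
    rw [← extendPerm_coe] at hx
    dsimp only at hx
    rw [hx, hgc, hac]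
    field_simp
  have key0 := key 0 le_rfl zero_le_one
  rw [add_zero] at key0
  refine ⟨d, ⟨c + (i - c'), ?_⟩, fun s hs hs' => ?_⟩
  · rw [key0]
    push_cast
    ring
  · rw [key s hs hs', key0]
    ring

/-- Every element of Thompson's group is the fraction of two trees, where the denominator may be
taken to be the tree of a uniform subdivision. -/
theorem IsDyadicPL.dyadicMap_extendPerm {g : Equiv.Perm unitInterval} (hg : IsDyadicPL g) :
    DyadicMap 1 1 (extendPerm g) := by
  obtain ⟨N, d, hd⟩ := hg.exists_uniform_subdivision
  have hpow : (0 : ℝ) < 2 ^ N := by positivity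
  have h0 : extendPerm g 0 = 0 := by
    rw [show (0 : ℝ) = (0 : unitInterval) from rfl, extendPerm_coe,
      map_zero_of_strictMono hg.strictMono]
  have h1 : extendPerm g 1 = 1 := by
    rw [show (1 : ℝ) = (1 : unitInterval) from rfl, extendPerm_coe,
      map_one_of_strictMono hg.strictMono]
  obtain ⟨s, hs, hs'⟩ := exists_tree_eq_subdivision (M := 2 ^ N) (h := fun x => x / 2 ^ N)
    (d := fun _ => N) (by simp) (by simp)
    (fun i _ => ⟨⟨i, by simp⟩, fun r _ _ => add_div _ _ _⟩)
  obtain ⟨t, ht, ht'⟩ := exists_tree_eq_subdivision (M := 2 ^ N)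
    (h := fun x => extendPerm g (x / 2 ^ N)) (d := d) (by simpa using h0) (by simpa using h1) hd
  have hst : extendPerm g ∘ subdivision s.depths = subdivision t.depths := by
    funext x
    rw [Function.comp_apply]
    rcases lt_or_ge x 0 with h | h
    · rw [subdivision_of_nonpos _ h.le, subdivision_of_nonpos _ h.le,
        extendPerm_of_notMem g fun hx => h.not_ge hx.1]
    rcases lt_or_ge x ((2 ^ N : ℕ) : ℝ) with h' | h'
    · rw [hs' x h h', ht' x h h']
    · rw [subdivision_of_length_le _ (by rwa [length_depths, hs]),
        subdivision_of_length_le _ (by rwa [length_depths, ht]), length_depths, length_depths, hs,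
        ht, totalLength_depths, totalLength_depths]
      rcases eq_or_lt_of_le h' with rfl | h'
      · simpa using h1
      · exact extendPerm_of_notMem g fun hx => by linarith [hx.2]
  obtain ⟨k, hk, -, hsk⟩ := (dyadicMap_subdivision s).exists_inverse
  rw [← Function.comp_id (extendPerm g), ← hsk, ← Function.comp_assoc, hst]
  rw [hs] at hk
  exact hk.comp (ht ▸ dyadicMap_subdivision t)

theorem DyadicMap.exists_trees {f : ℝ → ℝ} (hf : DyadicMap 1 1 f) :
    ∃ s t : BinTree, s.leaves = t.leaves ∧ f ∘ subdivision s.depths = subdivision t.depths := by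
  obtain ⟨-, φ, ψ, h, -⟩ := DyadicInterval.exists_corresponds_homOf.{0, 0}
    (DyadicInterval.generator.{0, 0}) hf
  have hφ : φ.length = 1 := by
    simpa [DyadicInterval.tensorPow_generator] using congrArg DyadicInterval.length h.src_eq.symm
  have hψ : ψ.length = 1 := by
    simpa [DyadicInterval.tensorPow_generator] using congrArg DyadicInterval.length h.tgt_eq.symm
  obtain ⟨s, rfl⟩ := List.length_eq_one_iff.1 hφ
  obtain ⟨t, rfl⟩ := List.length_eq_one_iff.1 hψ
  refine ⟨s, t, by simpa [forestLeaves] using h.leaves_eq, ?_⟩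
  have := congrArg (fun a => a.hom.fn) h.comp_eq
  simp only [DyadicInterval.arr_comp_fn h.tgt_eq_src, DyadicInterval.evalForest_fn] at this
  simp only [forestDepths, List.flatMap_singleton] at this
  exact this

/-- A fraction of two trees is a dyadic piecewise linear map: the pieces are the intervals of the
subdivision that the denominator prescribes. -/
theorem DyadicMap.isDyadicPL {g : Equiv.Perm unitInterval} (hg : DyadicMap 1 1 (extendPerm g)) :
    IsDyadicPL g := by
  classical
  obtain ⟨s, t, hst, h⟩ := hg.exists_trees
  have hs := (dyadicMap_subdivision s).isExtended
  have hmem : ∀ i ≤ s.leaves, subdivision s.depths i ∈ unitInterval := fun i hi =>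
    ⟨hs.nonneg (Nat.cast_nonneg i), by
      have := hs.strictMono.monotone (Nat.cast_le.2 hi)
      rwa [hs.map_end, Nat.cast_one] at this⟩
  let p : ℕ → unitInterval := fun i => Set.projIcc 0 1 zero_le_one (subdivision s.depths i)
  have hp : ∀ i ≤ s.leaves, (p i : ℝ) = subdivision s.depths i := fun i hi =>
    congrArg Subtype.val (Set.projIcc_of_mem zero_le_one (hmem i hi))
  have hgp : ∀ i ≤ s.leaves, (g (p i) : ℝ) = subdivision t.depths i := fun i hi => by
    rw [← extendPerm_coe, hp i hi, ← h, Function.comp_apply]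
  refine ⟨(Finset.range (s.leaves + 1)).image p, Finset.mem_image.2 ⟨0, by simp, ?_⟩,
    Finset.mem_image.2 ⟨s.leaves, by simp, ?_⟩, ?_, ?_⟩
  · ext
    rw [hp 0 (Nat.zero_le _), Nat.cast_zero, hs.map_zero]
    rfl
  · ext
    rw [hp _ le_rfl, hs.map_end, Nat.cast_one]
    rfl
  · intro a ha
    obtain ⟨i, hi, rfl⟩ := Finset.mem_image.1 ha
    have hi : i ≤ s.leaves := Nat.lt_succ_iff.1 (Finset.mem_range.1 hi)
    rw [hp i hi, hgp i hi]
    exact ⟨isDyadic_subdivision _ (by rwa [length_depths]),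
      isDyadic_subdivision _ (by rwa [length_depths, ← hst])⟩
  · intro a ha b hb hab hc
    obtain ⟨i, hi, rfl⟩ := Finset.mem_image.1 ha
    obtain ⟨j, hj, rfl⟩ := Finset.mem_image.1 hb
    have hi : i ≤ s.leaves := Nat.lt_succ_iff.1 (Finset.mem_range.1 hi)
    have hj : j ≤ s.leaves := Nat.lt_succ_iff.1 (Finset.mem_range.1 hj)
    have hlt : ∀ {k l : ℕ}, k ≤ s.leaves → l ≤ s.leaves → (p k < p l ↔ k < l) := by
      intro k l hk hl
      rw [← Subtype.coe_lt_coe, hp k hk, hp l hl, hs.strictMono.lt_iff_lt, Nat.cast_lt]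
    have hij := (hlt hi hj).1 hab
    obtain rfl : j = i + 1 := by
      by_contra hne
      exact hc (p (i + 1)) (Finset.mem_image_of_mem _ (Finset.mem_range.2 (by omega)))
        ⟨(hlt hi (by omega)).2 (by omega), (hlt (by omega) hj).2 (by omega)⟩
    obtain ⟨d, hd⟩ := exists_subdivision_add s.depths (i := i) (by rw [length_depths]; omega)
    obtain ⟨d', hd'⟩ := exists_subdivision_add t.depths (i := i) (by rw [length_depths]; omega)
    refine ⟨d - d', fun x hx hx' => ?_⟩
    rw [← Subtype.coe_le_coe, hp i hi] at hx
    rw [← Subtype.coe_le_coe, hp _ hj, Nat.cast_succ, hd 1 zero_le_one le_rfl] at hx'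
    have hpow : (0 : ℝ) < 2 ^ d := by positivity
    have hr : 0 ≤ ((x : ℝ) - subdivision s.depths i) * 2 ^ d :=
      mul_nonneg (sub_nonneg.2 hx) hpow.le
    have hr' : ((x : ℝ) - subdivision s.depths i) * 2 ^ d ≤ 1 := by
      rw [← le_div_iff₀ hpow]
      linarith
    have hx_eq := hd _ hr hr'
    rw [mul_div_cancel_right₀ _ hpow.ne', add_sub_cancel] at hx_eq
    rw [hgp i hi, hp i hi, ← extendPerm_coe, ← hx_eq, ← Function.comp_apply (f := extendPerm g), h,
      hd' _ hr hr', hx_eq, zpow_sub₀ two_ne_zero, zpow_natCast, zpow_natCast]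
    ring

/-- A dyadic map of `[0, 1]` restricts to a permutation of `[0, 1]`. -/
theorem DyadicMap.exists_extendPerm_eq {f : ℝ → ℝ} (hf : DyadicMap 1 1 f) :
    ∃ g : Equiv.Perm unitInterval, extendPerm g = f := by
  obtain ⟨k, hk, hkf, hfk⟩ := hf.exists_inverse
  have hmem : ∀ {f : ℝ → ℝ}, DyadicMap 1 1 f → ∀ x ∈ unitInterval, f x ∈ unitInterval := by
    intro f hf x hx
    have h := hf.isExtended
    refine ⟨h.nonneg hx.1, ?_⟩
    have := h.strictMono.monotone hx.2
    rwa [← Nat.cast_one, h.map_end, Nat.cast_one] at this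
  refine ⟨⟨fun x => ⟨f x, hmem hf x x.2⟩, fun x => ⟨k x, hmem hk x x.2⟩,
    fun x => Subtype.ext (congrFun hkf x), fun x => Subtype.ext (congrFun hfk x)⟩, ?_⟩
  funext x
  by_cases hx : x ∈ unitInterval
  · lift x to unitInterval using hx
    simp
  · rw [extendPerm_of_notMem _ hx]
    have h := hf.isExtended
    rcases lt_or_ge x 0 with h0 | h0
    · exact (h.of_nonpos x h0.le).symm
    · have h1 : 1 ≤ x := (not_le.1 fun h1 => hx ⟨h0, h1⟩).le
      rw [h.of_le x (by simpa using h1)]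
      simp

namespace DyadicInterval

/-- The endomorphism of `[0, 1]` given by an element of Thompson's group. -/
noncomputable def homOfThompson (g : ThompsonF) :
    Quiver.Hom.{v} (⟨1⟩ : DyadicInterval.{u}) ⟨1⟩ :=
  ⟨extendPerm g, g.2.dyadicMap_extendPerm⟩

theorem homOfThompson_one : homOfThompson.{v, u} 1 = 𝟙 (⟨1⟩ : DyadicInterval.{u}) :=
  hom_ext extendPerm_one

theorem homOfThompson_mul (g h : ThompsonF) :
    homOfThompson.{v, u} (g * h) = homOfThompson h ≫ homOfThompson g :=
  hom_ext (extendPerm_mul g h)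

theorem homOfThompson_injective : Function.Injective homOfThompson.{v, u} := fun _ _ h =>
  Subtype.ext (extendPerm_injective (congrArg Hom.fn h))

theorem homOfThompson_surjective : Function.Surjective homOfThompson.{v, u} := fun f => by
  have hf : DyadicMap 1 1 f.fn := f.dyadicMap
  obtain ⟨g, hg⟩ := hf.exists_extendPerm_eq
  exact ⟨⟨g, DyadicMap.isDyadicPL (hg ▸ hf)⟩, hom_ext hg⟩

/-- The action of Thompson's group on `[0, 1]` by automorphisms. -/
noncomputable def thompsonToAut : ThompsonF →* Aut.{v} (⟨1⟩ : DyadicInterval.{u}) where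
  toFun g :=
    { hom := homOfThompson g
      inv := homOfThompson g⁻¹
      hom_inv_id := by rw [← homOfThompson_mul, inv_mul_cancel, homOfThompson_one]
      inv_hom_id := by rw [← homOfThompson_mul, mul_inv_cancel, homOfThompson_one] }
  map_one' := Aut.ext homOfThompson_one
  map_mul' g h := Aut.ext (homOfThompson_mul g h)

theorem thompsonToAut_bijective : Function.Bijective thompsonToAut.{v, u} :=
  ⟨fun _ _ h => homOfThompson_injective (congrArg Iso.hom h), fun a =>
    (homOfThompson_surjective a.hom).imp fun _ hg => Aut.ext hg⟩

/-- The automorphism group of the generator is Thompson's group. -/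
noncomputable def autGeneratorEquiv : Aut.{v} (generator.{v, u}).obj ≃* ThompsonF :=
  (MulEquiv.ofBijective thompsonToAut thompsonToAut_bijective).symm

/-! ### The underlying category -/

/-- The functor from `1 ⨿ F` that sends the first object to `[0, 0]` and the second one
to `[0, 1]`. -/
noncomputable def ofSum : Functor.{0, v} (SingleObj PUnit.{1} ⊕ SingleObj ThompsonF)
    DyadicInterval.{u} :=
  Functor.sum' ((Functor.const _).obj ⟨0⟩)
    { obj := fun _ => ⟨1⟩
      map := fun g => homOfThompson g
      map_id := fun _ => homOfThompson_one
      map_comp := fun g h => homOfThompson_mul h g }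

/-- There is only one map `[0, 0] → [0, 0]`. -/
theorem hom_zero_ext (f g : DyadicInterval.Hom.{v} (⟨0⟩ : DyadicInterval.{u}) ⟨0⟩) : f = g := by
  have key : ∀ f : DyadicInterval.Hom.{v} (⟨0⟩ : DyadicInterval.{u}) ⟨0⟩, f.fn = id := by
    intro f
    have h := f.dyadicMap.isExtended
    funext x
    rcases le_total x 0 with hx | hx
    · exact h.of_nonpos x hx
    · simpa using h.of_le x (by simpa using hx)
  exact hom_ext ((key f).trans (key g).symm)

/-- A dyadic map fixes `0` and sends the right end of its domain to that of its codomain, so the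
interval `[0, 0]` is not connected to any other one. -/
theorem length_eq_zero_iff_of_hom {X Y : DyadicInterval.{u}} (f : DyadicInterval.Hom.{v} X Y) :
    X.length = 0 ↔ Y.length = 0 := by
  have h := f.dyadicMap.isExtended
  have h₀ := h.map_zero
  have h₁ := h.map_end
  rw [← Nat.cast_eq_zero (R := ℝ), ← Nat.cast_eq_zero (R := ℝ), ← h₁]
  exact ⟨fun hX => by rw [hX, h₀], fun hY => h.strictMono.injective (hY.trans h₀.symm)⟩

instance : (ofSum.{v, u}).Faithful where
  map_injective {X Y f g} h := by
    rcases X with X | X <;> rcases Y with Y | Y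
    · exact ULift.ext _ _ (Subsingleton.elim (α := PUnit) _ _)
    · exact f.elim
    · exact f.elim
    · exact ULift.ext _ _ (homOfThompson_injective h)

instance : (ofSum.{v, u}).Full where
  map_surjective {X Y} f := by
    rcases X with X | X <;> rcases Y with Y | Y
    · exact ⟨⟨PUnit.unit⟩, hom_zero_ext _ _⟩
    · exact absurd ((length_eq_zero_iff_of_hom f).1 rfl) one_ne_zero
    · exact absurd ((length_eq_zero_iff_of_hom f).2 rfl) one_ne_zero
    · obtain ⟨g, hg⟩ := homOfThompson_surjective f
      exact ⟨⟨g⟩, hg⟩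

theorem exists_dyadicMap_one (n : ℕ) : ∃ f, DyadicMap 1 (n + 1) f := by
  induction n with
  | zero => exact ⟨_, .id 1⟩
  | succ n ih =>
    obtain ⟨f, hf⟩ := ih
    refine ⟨_, hf.comp (?_ : DyadicMap (n + 1) (n + 1 + 1) (juxtapose n n id double))⟩
    exact (DyadicMap.id n).juxtapose .double

instance : (ofSum.{v, u}).EssSurj where
  mem_essImage := by
    rintro ⟨_ | n⟩
    · exact ⟨Sum.inl (SingleObj.star _), ⟨Iso.refl _⟩⟩
    · obtain ⟨f, hf⟩ := exists_dyadicMap_one n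
      exact ⟨Sum.inr (SingleObj.star _), ⟨isoOfHom (homOf hf)⟩⟩

instance : (ofSum.{v, u}).IsEquivalence where

end DyadicInterval

/-! ### Uniqueness of the free strict monoidal category -/

section Uniqueness

theorem IsStrictMonoidalFunctor.id (C : Type u) [Category.{v} C] [MonoidalCategory C] :
    IsStrictMonoidalFunctor (𝟭 C) where
  obj_unit := rfl
  obj_tensor _ _ := rfl
  map_tensor f g := by simp

theorem IdempotentObject.map_id {C : Type u} [Category.{v} C] [MonoidalCategory C]
    (a : IdempotentObject C) : a.map (𝟭 C) (.id C) = a :=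
  ext_of_arr rfl (by simp [IdempotentObject.map])

variable {C : Type u} [Category.{v} C] [MonoidalCategory C]
  {D : Type u₁} [Category.{v₁} D] [MonoidalCategory D]
  {E : Type u₂} [Category.{v₂} E] [MonoidalCategory E]

theorem IsStrictMonoidalFunctor.comp {G : C ⥤ D} {H : D ⥤ E} (hG : IsStrictMonoidalFunctor G)
    (hH : IsStrictMonoidalFunctor H) : IsStrictMonoidalFunctor (G ⋙ H) where
  obj_unit := (congrArg H.obj hG.obj_unit).trans hH.obj_unit
  obj_tensor X Y := (congrArg H.obj (hG.obj_tensor X Y)).trans (hH.obj_tensor _ _)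
  map_tensor f g := by
    rw [Functor.comp_map, hG.map_tensor, H.map_comp, H.map_comp, hH.map_tensor, eqToHom_map,
      eqToHom_map]
    simp

theorem IdempotentObject.map_comp (a : IdempotentObject C) {G : C ⥤ D} {H : D ⥤ E}
    (hG : IsStrictMonoidalFunctor G) (hH : IsStrictMonoidalFunctor H) :
    a.map (G ⋙ H) (hG.comp hH) = (a.map G hG).map H hH :=
  ext_of_arr rfl (by simp [IdempotentObject.map, eqToHom_map])

/-- A category freely generated by an idempotent object is unique up to isomorphism. -/
theorem IsFreelyGeneratedBy.exists_equivalence {A B : Type u} [Category.{v} A]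
    [MonoidalCategory A] [StrictMonoidal A] [Category.{v} B] [MonoidalCategory B]
    [StrictMonoidal B] {a : IdempotentObject A} {b : IdempotentObject B}
    (ha : IsFreelyGeneratedBy A a) (hb : IsFreelyGeneratedBy B b) :
    ∃ e : A ≌ B, e.functor.obj a.obj = b.obj := by
  obtain ⟨G, ⟨hG, hGa⟩, -⟩ := ha B b
  obtain ⟨H, ⟨hH, hHb⟩, -⟩ := hb A a
  have hGH : G ⋙ H = 𝟭 A := (ha A a).unique
    ⟨hG.comp hH, by rw [a.map_comp hG hH]; simp only [hGa, hHb]⟩ ⟨.id A, a.map_id⟩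
  have hHG : H ⋙ G = 𝟭 B := (hb B b).unique
    ⟨hH.comp hG, by rw [b.map_comp hH hG]; simp only [hGa, hHb]⟩ ⟨.id B, b.map_id⟩
  exact ⟨.mk G H (eqToIso hGH.symm) (eqToIso hHG), congrArg IdempotentObject.obj hGa⟩

end Uniqueness

theorem theorem1 :
    (∃ (𝒜 : Type u) (_ : Category.{v} 𝒜) (_ : MonoidalCategory 𝒜) (_ : StrictMonoidal 𝒜)
      (a : IdempotentObject 𝒜), IsFreelyGeneratedBy 𝒜 a) ∧
    ∀ (𝒜 : Type u) [Category.{v} 𝒜] [MonoidalCategory 𝒜] [StrictMonoidal 𝒜]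
      (a : IdempotentObject 𝒜), IsFreelyGeneratedBy 𝒜 a →
      Nonempty (Aut a.obj ≃* ThompsonF) ∧
      Nonempty (𝒜 ≌ (SingleObj PUnit.{1} ⊕ SingleObj ThompsonF)) := by
  refine ⟨⟨DyadicInterval, inferInstance, inferInstance, inferInstance, DyadicInterval.generator,
    DyadicInterval.isFreelyGeneratedBy_generator⟩, ?_⟩
  intro 𝒜 _ _ _ a ha
  obtain ⟨e, he⟩ := ha.exists_equivalence DyadicInterval.isFreelyGeneratedBy_generator
  exact ⟨⟨(e.fullyFaithfulFunctor.autMulEquivOfFullyFaithful a.obj).trans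
    ((Aut.autMulEquivOfIso (eqToIso he)).trans DyadicInterval.autGeneratorEquiv)⟩,
    ⟨e.trans DyadicInterval.ofSum.asEquivalence.symm⟩⟩
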